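/- **Setting.** Let $d\ge 1$, $T=[0,1]^d$, and let $\|\cdot\|_\infty$ denote the maximum norm on $\mathbb R^d$ and the supremum norm of functions on $T$. For $\boldsymbol p=(p_1,\dots,p_d)\in\mathbb N^d$ put $\boldsymbol p_{\min}=\min_k p_k$ and $\boldsymbol p^{\boldsymbol 1}=\prod_k p_k$. Let design points $x_{\boldsymbol j}=(x_{1,j_1},\dots,x_{d,j_d})\in T$, $\boldsymbol 1\le\boldsymbol j\le\boldsymbol p$, with $x_{k,1}<\dots<x_{k,p_k}$ for every $k$ be given, and let $$Y_{i,\boldsymbol j}=\mu(x_{\boldsymbol j})+Z_i(x_{\boldsymbol j})+\varepsilon_{i,\boldsymbol j},\qquad 1\le i\le n,\ \boldsymbol 1\le\boldsymbol j\le\boldsymbol p .$$ Fix $\alpha>0$, $L>0$, $\beta_0\in(0,1]$, $C_Z>0$, $\zeta>0$, $\sigma\ge0$, $c,h_0>0$ and $C_1,C_2,C_3>0$, and let $\lfloor\alpha\rfloor$ be the largest integer in $\mathbb N_0$ that is strictly smaller than $\alpha$. * *Mean functions.* $\mathcal H(\alpha,L)$ is the class of functions $\mu:T\to\mathbb R$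 whose partial derivatives up to order $\lfloor\alpha\rfloor$ exist on $T$ and satisfy $$\max_{|\boldsymbol\beta|\le\lfloor\alpha\rfloor}\sup_{x\in T}|\partial^{\boldsymbol\beta}\mu(x)|+\max_{|\boldsymbol\beta|=\lfloor\alpha\rfloor}\sup_{x\ne y\in T}\frac{|\partial^{\boldsymbol\beta}\mu(x)-\partial^{\boldsymbol\beta}\mu(y)|}{\|x-y\|_\infty^{\alpha-\lfloor\alpha\rfloor}}\le L .$$ * *Processes.* $Z_1,\dots,Z_n$ are independent centered random fields on $T$, all distributed as a random field $Z\in\mathcal P_T(\beta_0,C_Z)$: there are $\beta\in[\beta_0,1]$ and a random variable $M>0$ with $\mathbb E[M^2]+\mathbb E[Z(0)^2]\le C_Z$ such that $|Z(x)-Z(y)|\le M\|x-y\|_\infty^{\beta}$ almost surely, for all $x,y\in T$. * *Errors.* The $\varepsilon_{i,\boldsymbol j}$ are independent, centered, independent of $(Z_1,\dots,Z_n)$, with variances $\sigma_{i,\boldsymbol j}^2\le\sigma^2$, and sub-Gaussian with variance proxy $\zeta^2\sigma_{i,\boldsymbol j}^2$, that is, $\mathbb E\,e^{t\varepsilon_{i,\boldsymbol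 j}}\le e^{\zeta^2\sigma_{i,\boldsymbol j}^2t^2/2}$ for all $t\in\mathbb R$. * *Design.* For all $h\in(c/\boldsymbol p_{\min},h_0]$ and $x\in T$, at most $C_3h^d\boldsymbol p^{\boldsymbol 1}$ of the indices $\boldsymbol j$ satisfy $\|x_{\boldsymbol j}-x\|_\infty\le h$. * *Weights.* The deterministic weights $w_{\boldsymbol j}(x;h)$, which may depend on the design, satisfy for all $h\in(c/\boldsymbol p_{\min},h_0]$ and all $x,y\in T$: (W1) $\sum_{\boldsymbol j}w_{\boldsymbol j}(x;h)=1$ and $\sum_{\boldsymbol j}(x_{\boldsymbol j}-x)^{\boldsymbol r}w_{\boldsymbol j}(x;h)=0$ for $\boldsymbol r\in\mathbb N_0^d$ with $1\le|\boldsymbol r|\le\lfloor\alpha\rfloor$; (W2) $w_{\boldsymbol j}(x;h)=0$ if $\|x_{\boldsymbol j}-x\|_\infty>h$; (W3) $|w_{\boldsymbol j}(x;h)|\le C_1/(\boldsymbol p^{\boldsymbol 1}h^d)$; (W4) $|w_{\boldsymbol j}(x;h)-w_{\boldsymbol j}(y;h)|\le\frac{C_2}{\boldsymbol p^{\boldsymbol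 1}h^d}\min\big(\|x-y\|_\infty/h,\,1\big)$. The estimator is $\widehat\mu_{n,\boldsymbol p,h}(x)=\sum_{\boldsymbol j}w_{\boldsymbol j}(x;h)\,\frac1n\sum_{i=1}^nY_{i,\boldsymbol j}$. **Theorem.** (a) There are constants $K$ and $N$, depending only on $d$ and on the constants fixed above, such that whenever $n\ge N$ and $\boldsymbol p_{\min}\ge N$, for all designs, weights, processes and errors as above, all $\mu\in\mathcal H(\alpha,L)$ and all $h\in(c/\boldsymbol p_{\min},h_0]$, $$\mathbb E\big[\|\widehat\mu_{n,\boldsymbol p,h}-\mu\|_\infty\big]\le K\,\max\Big(h^\alpha,\Big(\frac{\log(1/h)}{n\,\boldsymbol p^{\boldsymbol 1}h^d}\Big)^{1/2},n^{-1/2}\Big),$$ where the square root is read as $0$ if $h>1$. (b) Let $c'\ge c$ and $$h^\star=\max\Big(\frac{c'}{\boldsymbol p_{\min}},\Big(\frac{\log(n\boldsymbol p^{\boldsymbol 1})}{n\boldsymbol p^{\boldsymbol 1}}\Big)^{1/(2\alpha+d)}\Big);$$ if $c'=c$, assume in addition that (W1)–(W4) also hold for $h=c/\boldsymbol p_{\min}$.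 Then there are constants $K$ and $N$, depending only on $d$, $c'$ and the constants fixed above, such that whenever $n\ge N$ and $\boldsymbol p_{\min}\ge N$, for all designs, weights, processes and errors as above and all $\mu\in\mathcal H(\alpha,L)$, $$\mathbb E\big[\|\widehat\mu_{n,\boldsymbol p,h^\star}-\mu\|_\infty\big]\le K\,\max\Big(\boldsymbol p_{\min}^{-\alpha},\Big(\frac{\log(n\boldsymbol p^{\boldsymbol 1})}{n\boldsymbol p^{\boldsymbol 1}}\Big)^{\alpha/(2\alpha+d)},n^{-1/2}\Big).$$ -/

import Mathlib

open MeasureTheory ProbabilityTheory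
open scoped ENNReal NNReal

namespace MeanEst

noncomputable section

/-- The hypercube `T = [0,1]^d`, inside `Fin d → ℝ`, whose norm is the maximum norm. -/
abbrev cube (d : ℕ) : Set (Fin d → ℝ) := Set.Icc 0 1

/-- The origin, as a point of the cube. -/
def origin (d : ℕ) : cube d := ⟨0, Set.left_mem_Icc.2 zero_le_one⟩

/-- The multi-indices `𝟏 ≤ j ≤ p`. -/
abbrev Idx {d : ℕ} (p : Fin d → ℕ) : Type := (k : Fin d) → Fin (p k)

/-- `p_min`, the minimum of the coordinates of `p`. -/
def pMin {d : ℕ} (p : Fin d → ℕ) : ℕ := ⨅ k, p k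

/-- `p^𝟏`, the product of the coordinates of `p`, which is the number of design points. -/
def pProd {d : ℕ} (p : Fin d → ℕ) : ℕ := ∏ k, p k

/-! ### Hölder classes -/

/-- The largest integer in `ℕ₀` that is strictly smaller than `α > 0`. -/
def strictFloor (α : ℝ) : ℕ := ⌈α⌉₊ - 1

/-- The partial derivative `∂_{s 0} ⋯ ∂_{s (r-1)} f (x)` of order `r` on the closed cube
(one-sided at the boundary). For `f` of class `C^r` on the cube it only depends on how often each
coordinate occurs in `s`, that is, on the multi-index of `s`. -/
def partialDeriv {d : ℕ} (f : (Fin d → ℝ) → ℝ) {r : ℕ} (s : Fin r → Fin d) (x : Fin d → ℝ) : ℝ :=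
  iteratedFDerivWithin ℝ r f (cube d) x (fun i => Pi.single (s i) 1)

/-- The Hölder norm of index `α`, with values in `[0, ∞]`. -/
def holderNorm {d : ℕ} (α : ℝ) (f : (Fin d → ℝ) → ℝ) : ℝ≥0∞ :=
  (⨆ (r : ℕ) (_ : r ≤ strictFloor α) (s : Fin r → Fin d) (x : cube d), ‖partialDeriv f s x‖ₑ) +
  ⨆ (s : Fin (strictFloor α) → Fin d) (x : cube d) (y : cube d) (_ : x ≠ y),
    ‖partialDeriv f s x - partialDeriv f s y‖ₑ /
      ENNReal.ofReal (‖(x : Fin d → ℝ) - y‖ ^ (α - strictFloor α))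

/-- The Hölder class on the cube: only the values of `f` on the cube matter. If all partial
derivatives up to the order `strictFloor α` exist on the cube and those of top order are Hölder
continuous, then `f` is of class `C^(strictFloor α)` there, which is how existence of the
derivatives is expressed. -/
def HolderClass {d : ℕ} (α L : ℝ) : Set ((Fin d → ℝ) → ℝ) :=
  {f | ContDiffOn ℝ (strictFloor α : ℕ) f (cube d) ∧ holderNorm α f ≤ ENNReal.ofReal L}

/-! ### The class of processes -/

/-- The random field `Z` on the cube belongs to the class of processes with parameters
`β₀` and `C_Z`. -/
def InProcessClass {d : ℕ} {Ω : Type*} [MeasurableSpace Ω] (P : Measure Ω) (β₀ CZ : ℝ)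
    (Z : Ω → cube d → ℝ) : Prop :=
  (∀ x, Measurable fun ω => Z ω x) ∧
  ∃ β ∈ Set.Icc β₀ 1, ∃ M : Ω → ℝ, Measurable M ∧ (∀ᵐ ω ∂P, 0 < M ω) ∧
    MemLp M 2 P ∧ MemLp (fun ω => Z ω (origin d)) 2 P ∧
    (∫ ω, M ω ^ 2 ∂P) + (∫ ω, Z ω (origin d) ^ 2 ∂P) ≤ CZ ∧
    ∀ x y : cube d, ∀ᵐ ω ∂P, |Z ω x - Z ω y| ≤ M ω * ‖(x : Fin d → ℝ) - y‖ ^ β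

/-! ### Design, weights, model and estimator -/

/-- A design with Cartesian product structure: strictly increasing coordinates in `[0,1]`. -/
structure ProductDesign {d : ℕ} (p : Fin d → ℕ) where
  /-- the coordinates `x_{k,l}` -/
  coord : (k : Fin d) → Fin (p k) → ℝ
  strictMono : ∀ k, StrictMono (coord k)
  mem_Icc : ∀ k l, coord k l ∈ Set.Icc (0 : ℝ) 1

/-- The design point `x_j = (x_{1,j_1}, …, x_{d,j_d})`. -/
def ProductDesign.pt {d : ℕ} {p : Fin d → ℕ} (D : ProductDesign p) (j : Idx p) : cube d :=
  ⟨fun k => D.coord k (j k), fun k => (D.mem_Icc k (j k)).1, fun k => (D.mem_Icc k (j k)).2⟩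

/-- At most `C₃ h^d p^𝟏` design points lie in each box of centre `x ∈ T` and half side length `h`,
for all `h` in the range of bandwidths `(c / p_min, h₀]`. -/
def DesignCondition {d : ℕ} {p : Fin d → ℕ} (D : ProductDesign p) (c h₀ C₃ : ℝ) : Prop :=
  ∀ h ∈ Set.Ioc (c / pMin p) h₀, ∀ x : cube d,
    (Nat.card {j : Idx p // ∀ k, x.1 k - h ≤ (D.pt j).1 k ∧ (D.pt j).1 k ≤ x.1 k + h} : ℝ)
      ≤ C₃ * h ^ d * pProd p

/-- The conditions on the weights `w_j(x)` belonging to one bandwidth `h`: reproduction of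
polynomials up to the degree `γ`, localization, size, and Lipschitz continuity. -/
structure WeightConditions {d : ℕ} {p : Fin d → ℕ} (D : ProductDesign p) (γ : ℕ) (C₁ C₂ h : ℝ)
    (w : Idx p → cube d → ℝ) : Prop where
  sum_eq_one : ∀ x, ∑ j, w j x = 1
  sum_monomial : ∀ r : Fin d → ℕ, 1 ≤ ∑ k, r k → ∑ k, r k ≤ γ → ∀ x : cube d,
    ∑ j, (∏ k, ((D.pt j).1 k - x.1 k) ^ r k) * w j x = 0
  vanish : ∀ j (x : cube d), h < ‖((D.pt j : cube d) : Fin d → ℝ) - x‖ → w j x = 0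
  abs_le : ∀ j x, |w j x| ≤ C₁ / (pProd p * h ^ d)
  lipschitz : ∀ j (x y : cube d),
    |w j x - w j y| ≤ C₂ / (pProd p * h ^ d) * min (‖(x : Fin d → ℝ) - y‖ / h) 1

/-- The distributional assumptions: `Zs 0, …, Zs (n-1)` are independent centered random fields,
distributed as the generic `Z`, and the errors are independent, centered and independent of these
fields. Their variances are at most `σ²`, and `ζ²` times the variance of an error is an upper bound
for its sub-Gaussian parameter (variance proxy). -/
structure ModelAssumptions {d n : ℕ} {p : Fin d → ℕ}
    {Ω Ω' : Type*} [MeasurableSpace Ω] [MeasurableSpace Ω'] (P : Measure Ω) (P' : Measure Ω')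
    (ζ σ : ℝ) (Z : Ω' → cube d → ℝ) (Zs : Fin n → Ω → cube d → ℝ)
    (ε : Fin n → Idx p → Ω → ℝ) : Prop where
  measurable_field : ∀ i x, Measurable fun ω => Zs i ω x
  indep_field : iIndepFun Zs P
  identDistrib_field : ∀ i, IdentDistrib (Zs i) Z P P'
  centered_field : ∀ x, ∫ ω, Z ω x ∂P' = 0
  measurable_error : ∀ i j, Measurable (ε i j)
  indep_error : iIndepFun (fun ij : Fin n × Idx p => ε ij.1 ij.2) P
  indep_error_field : IndepFun (fun ω (ij : Fin n × Idx p) => ε ij.1 ij.2 ω) (fun ω i => Zs i ω) P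
  centered_error : ∀ i j, ∫ ω, ε i j ω ∂P = 0
  variance_error : ∀ i j, ∫ ω, ε i j ω ^ 2 ∂P ≤ σ ^ 2
  subgaussian_error : ∀ i j,
    HasSubgaussianMGF (ε i j) (ζ ^ 2 * ∫ ω, ε i j ω ^ 2 ∂P).toNNReal P

/-- The observations `Y_{i,j} = μ(x_j) + Z_i(x_j) + ε_{i,j}`. -/
def response {d n : ℕ} {p : Fin d → ℕ} {Ω : Type*} (D : ProductDesign p) (μ : (Fin d → ℝ) → ℝ)
    (Zs : Fin n → Ω → cube d → ℝ) (ε : Fin n → Idx p → Ω → ℝ) (i : Fin n) (j : Idx p) (ω : Ω) : ℝ :=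
  μ (D.pt j) + Zs i ω (D.pt j) + ε i j ω

/-- The linear estimator `∑ⱼ wⱼ(x) Ȳⱼ`, where `Ȳⱼ` is the average of `Y i j` over `i`. -/
def linearEstimator {d n : ℕ} {p : Fin d → ℕ} {Ω : Type*} (w : Idx p → cube d → ℝ)
    (Y : Fin n → Idx p → Ω → ℝ) (x : cube d) (ω : Ω) : ℝ :=
  ∑ j, w j x * ((1 / (n : ℝ)) * ∑ i, Y i j ω)

/-- The expected sup-norm error of the linear estimator, with values in `[0, ∞]`. -/
def expectedSupError {d n : ℕ} {p : Fin d → ℕ} {Ω : Type*} [MeasurableSpace Ω] (P : Measure Ω)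
    (D : ProductDesign p) (w : Idx p → cube d → ℝ) (μ : (Fin d → ℝ) → ℝ)
    (Zs : Fin n → Ω → cube d → ℝ) (ε : Fin n → Idx p → Ω → ℝ) : ℝ≥0∞ :=
  ∫⁻ ω, ⨆ x : cube d, ‖linearEstimator w (response D μ Zs ε) x ω - μ x‖ₑ ∂P

/-! ### Rates -/

/-- The bound `max (h^α, (log(1/h) / (n p^𝟏 h^d))^{1/2}, n^{-1/2})`; the square root of a negative
number (the case `h > 1`) is `0`. -/
def rate {d : ℕ} (α : ℝ) (n : ℕ) (p : Fin d → ℕ) (h : ℝ) : ℝ :=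
  max (h ^ α) (max (Real.sqrt (Real.log h⁻¹ / (n * pProd p * h ^ d))) ((n : ℝ) ^ (-(1 / 2) : ℝ)))

/-- The bandwidth `max (c / p_min, (log(n p^𝟏) / (n p^𝟏))^{1/(2α+d)})`. -/
def hStar {d : ℕ} (α c : ℝ) (n : ℕ) (p : Fin d → ℕ) : ℝ :=
  max (c / pMin p) ((Real.log (n * pProd p) / (n * pProd p)) ^ (1 / (2 * α + d)))

/-- The rate `max (p_min^{-α}, (log(n p^𝟏) / (n p^𝟏))^{α/(2α+d)}, n^{-1/2})`. -/
def optimalRate {d : ℕ} (α : ℝ) (n : ℕ) (p : Fin d → ℕ) : ℝ :=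
  max ((pMin p : ℝ) ^ (-α))
    (max ((Real.log (n * pProd p) / (n * pProd p)) ^ (α / (2 * α + d))) ((n : ℝ) ^ (-(1 / 2) : ℝ)))

end

end MeanEst

open MeanEst

namespace MeanEst

/-! ### Sub-Gaussian maximal inequality -/

section Maximal

variable {Ω : Type*} [MeasurableSpace Ω] {P : Measure Ω}

/-! The error splits into bias, averaged process and averaged noise. Each is dominated by a quantity
free of x, and `expectedSupError_le` adds the three bounds.

Bias (`abs_bias_le`): the weights reproduce polynomials up to degree `strictFloor α` and live on a
box of half side h, so only a Taylor remainder of order h^α survives.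

Process (`integral_norm_sum_process_le`): the sums ∑ |w_j| are bounded, so it suffices to control
the averages of the Z_i over the design points, by n^{-1/2} times a constant free of the number of
points. A union bound over these points would cost a logarithm. Instead random signs are inserted
(`integral_norm_sum_le_sum_sgn`). With the paths frozen, the signed sums are sub-Gaussian with
increments governed by Hölder constants, and dyadic chaining (`sum_sgn_chaining_le`) yields a
convergent series.

Noise (`exists_noise_bound`): at a fixed x the variance proxy is of order 1/(n p^𝟏 h^d). A maximum
over a grid of size polynomial in 1/h costs the factor √log(1/h) (`integral_pi_norm_le`), and
Lipschitz continuity of the weights extends the bound to the cube at the price n^{-1/2}.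

The bandwidth in (b) contains the solution b of b^{2α+d} = log m / m with m = n p^𝟏, which balances
bias against noise (`rate_hStar_le`). -/

lemma hasSubgaussianMGF_mono {X : Ω → ℝ} {c c' : ℝ≥0} (h : HasSubgaussianMGF X c P)
    (hc : c ≤ c') : HasSubgaussianMGF X c' P where
  integrable_exp_mul := h.integrable_exp_mul
  mgf_le t := (h.mgf_le t).trans <| Real.exp_le_exp.2 <| by
    have : (c : ℝ) ≤ c' := by exact_mod_cast hc
    gcongr

variable {ι : Type*} [Fintype ι]

lemma integrable_pi_norm {X : ι → Ω → ℝ} (hX : ∀ j, Integrable (X j) P) :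
    Integrable (fun ω => ‖fun j => X j ω‖) P :=
  (Integrable.of_eval hX).norm

/-- The exponential-moment form of the maximal inequality, before optimizing in `t`. -/
lemma mul_integral_pi_norm_le [IsProbabilityMeasure P] [Nonempty ι] {X : ι → Ω → ℝ} {c : ℝ≥0}
    {N : ℝ} (hcard : (Fintype.card ι : ℝ) ≤ N)
    (hX : ∀ j, HasSubgaussianMGF (X j) c P) {t : ℝ} (ht : 0 ≤ t) :
    t * ∫ ω, ‖fun j => X j ω‖ ∂P ≤ Real.log (2 * N) + c * t ^ 2 / 2 := by
  have hN : 0 < N := lt_of_lt_of_le (by exact_mod_cast Fintype.card_pos) hcard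
  set A : ℝ := 2 * N * Real.exp (c * t ^ 2 / 2) with hA
  have hApos : 0 < A := by positivity
  have hlogA : Real.log A = Real.log (2 * N) + c * t ^ 2 / 2 := by
    rw [hA, Real.log_mul (by positivity) (by positivity), Real.log_exp]
  have hint : ∀ s : ℝ, ∀ j, Integrable (fun ω => Real.exp (s * X j ω)) P :=
    fun s j => (hX j).integrable_exp_mul s
  set S : Ω → ℝ := fun ω => ∑ j, (Real.exp (t * X j ω) + Real.exp (-t * X j ω)) with hS
  have hint2 : ∀ j, Integrable (fun ω => Real.exp (t * X j ω) + Real.exp (-t * X j ω)) P :=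
    fun j => (hint t j).add (hint (-t) j)
  have hSint : Integrable S P := integrable_finsetSum _ fun j _ => hint2 j
  have hSle : ∫ ω, S ω ∂P ≤ A := by
    rw [hS, integral_finsetSum _ fun j _ => hint2 j]
    calc ∑ j, ∫ ω, (Real.exp (t * X j ω) + Real.exp (-t * X j ω)) ∂P
        ≤ ∑ _j : ι, 2 * Real.exp (c * t ^ 2 / 2) := by
          refine Finset.sum_le_sum fun j _ => ?_
          rw [integral_add (hint t j) (hint (-t) j)]
          have h1 := (hX j).mgf_le t
          have h2 := (hX j).mgf_le (-t)
          simp only [mgf, neg_sq] at h1 h2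
          linarith
      _ = Fintype.card ι * (2 * Real.exp (c * t ^ 2 / 2)) := by simp
      _ ≤ N * (2 * Real.exp (c * t ^ 2 / 2)) := by gcongr
      _ = A := by rw [hA]; ring
  -- The tangent line of log at `A` plays the role of Jensen's inequality: `log S ≤ log A + S / A -
  -- 1`, and the last two terms have nonpositive total mean because `𝔼 S ≤ A`.
  have hpt1 : ∀ ω j, t * |X j ω| ≤ Real.log A + (S ω / A - 1) := by
    intro ω j
    have h1 := Real.add_one_le_exp (t * |X j ω| - Real.log A)
    rw [Real.exp_sub, Real.exp_log hApos] at h1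
    have h2 : Real.exp (t * |X j ω|) ≤ S ω := by
      refine le_trans ?_ (Finset.single_le_sum (f := fun j =>
        Real.exp (t * X j ω) + Real.exp (-t * X j ω)) (fun i _ => by positivity)
        (Finset.mem_univ j))
      rcases abs_cases (X j ω) with h | h
      · rw [h.1]
        exact le_add_of_nonneg_right (Real.exp_pos _).le
      · rw [h.1, mul_neg, ← neg_mul]
        exact le_add_of_nonneg_left (Real.exp_pos _).le
    have h3 : Real.exp (t * |X j ω|) / A ≤ S ω / A := by gcongr
    linarith
  have hpt : ∀ ω, t * ‖fun j => X j ω‖ ≤ Real.log A + (S ω / A - 1) := by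
    intro ω
    obtain ⟨j₀⟩ := ‹Nonempty ι›
    have h0 : 0 ≤ Real.log A + (S ω / A - 1) := le_trans (by positivity) (hpt1 ω j₀)
    have : ‖t • fun j => X j ω‖ ≤ Real.log A + (S ω / A - 1) := by
      rw [pi_norm_le_iff_of_nonneg h0]
      intro j
      simpa [abs_mul, abs_of_nonneg ht] using hpt1 ω j
    rwa [norm_smul, Real.norm_of_nonneg ht] at this
  have hSA' : Integrable (fun ω => S ω / A - 1) P := (hSint.div_const A).sub (integrable_const _)
  have hSA : Integrable (fun ω => Real.log A + (S ω / A - 1)) P := (integrable_const _).add hSA'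
  calc t * ∫ ω, ‖fun j => X j ω‖ ∂P = ∫ ω, t * ‖fun j => X j ω‖ ∂P := by
        rw [integral_const_mul]
    _ ≤ ∫ ω, (Real.log A + (S ω / A - 1)) ∂P :=
        integral_mono ((integrable_pi_norm fun j => (hX j).integrable).const_mul t) hSA hpt
    _ = Real.log A + ((∫ ω, S ω ∂P) / A - 1) := by
        rw [integral_add (integrable_const _) hSA',
          integral_sub (hSint.div_const A) (integrable_const _), integral_div]
        simp
    _ ≤ Real.log A := by
        have : (∫ ω, S ω ∂P) / A ≤ 1 := (div_le_one hApos).2 hSle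
        linarith
    _ = _ := hlogA

/-- The expected maximum of `N` sub-Gaussian variables. -/
theorem integral_pi_norm_le [IsProbabilityMeasure P] [Nonempty ι] {X : ι → Ω → ℝ} {s N : ℝ}
    (hs : 0 ≤ s) (hcard : (Fintype.card ι : ℝ) ≤ N)
    (hX : ∀ j, HasSubgaussianMGF (X j) (s ^ 2).toNNReal P) :
    ∫ ω, ‖fun j => X j ω‖ ∂P ≤ s * Real.sqrt (2 * Real.log (2 * N)) := by
  have hN : 1 ≤ N := le_trans (by exact_mod_cast Fintype.card_pos) hcard
  set a := Real.sqrt (2 * Real.log (2 * N)) with ha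
  have hlog : 0 < Real.log (2 * N) := Real.log_pos (by linarith)
  have hapos : 0 < a := Real.sqrt_pos.2 (by positivity)
  have hasq : a ^ 2 = 2 * Real.log (2 * N) := Real.sq_sqrt (by positivity)
  -- The optimal parameter is `t = a / s`, which is meaningless for `s = 0`; hence `t = a / r` with
  -- `r > s`, and `r` decreases to `s` at the end.
  have hpos : ∀ r : ℝ, s < r → ∫ ω, ‖fun j => X j ω‖ ∂P ≤ r * a := by
    intro r hr
    have hr0 : 0 < r := lt_of_le_of_lt hs hr
    have h := mul_integral_pi_norm_le hcard hX (t := a / r) (by positivity)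
    have hc : (((s ^ 2).toNNReal : ℝ≥0) : ℝ) ≤ r ^ 2 := by
      rw [Real.coe_toNNReal _ (by positivity)]
      gcongr
    have h2 : a / r * ∫ ω, ‖fun j => X j ω‖ ∂P ≤ a ^ 2 := by
      calc _ ≤ _ := h
        _ ≤ Real.log (2 * N) + r ^ 2 * (a / r) ^ 2 / 2 := by gcongr
        _ = a ^ 2 := by
          have : r ^ 2 * (a / r) ^ 2 = a ^ 2 := by field_simp
          rw [this, hasq]; ring
    have h3 : a * ∫ ω, ‖fun j => X j ω‖ ∂P ≤ a * (r * a) := by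
      rw [div_mul_eq_mul_div, div_le_iff₀ hr0] at h2
      linarith
    exact le_of_mul_le_mul_left h3 hapos
  rw [← div_le_iff₀ hapos]
  refine le_of_forall_gt_imp_ge_of_dense fun r hr => ?_
  rw [div_le_iff₀ hapos]
  exact hpos r hr

end Maximal

/-! ### Random signs -/

section Signs

/-- The sign `±1` encoded by a Boolean. -/
def sgn (b : Bool) : ℝ := if b then 1 else -1

lemma abs_sgn (b : Bool) : |sgn b| = 1 := by cases b <;> simp [sgn]

/-- The sum over sign vectors factorizes over the coordinates into terms `2 cosh (t * a i)`, and
`cosh u ≤ exp (u² / 2)`. -/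
lemma sum_exp_sgn_le {n : ℕ} (a : Fin n → ℝ) (t : ℝ) :
    ∑ e : Fin n → Bool, Real.exp (t * ∑ i, sgn (e i) * a i) ≤
      2 ^ n * Real.exp ((∑ i, a i ^ 2) * t ^ 2 / 2) := by
  have h1 : ∀ e : Fin n → Bool, Real.exp (t * ∑ i, sgn (e i) * a i) =
      ∏ i, Real.exp (t * (sgn (e i) * a i)) := fun e => by
    rw [Finset.mul_sum, Real.exp_sum]
  simp_rw [h1]
  have h2 := Finset.prod_univ_sum (fun _ : Fin n => (Finset.univ : Finset Bool))
    (fun i b => Real.exp (t * (sgn b * a i)))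
  rw [Fintype.piFinset_univ] at h2
  rw [← h2]
  calc ∏ i, ∑ b : Bool, Real.exp (t * (sgn b * a i))
      ≤ ∏ i, 2 * Real.exp ((t * a i) ^ 2 / 2) := by
        refine Finset.prod_le_prod (fun i _ => by positivity) fun i _ => ?_
        have := Real.cosh_le_exp_half_sq (t * a i)
        rw [Real.cosh_eq] at this
        simp only [Fintype.sum_bool, sgn, if_true, one_mul, Bool.false_eq_true, if_false, neg_mul,
          mul_neg]
        linarith
    _ = _ := by
        rw [Finset.prod_mul_distrib, ← Real.exp_sum]
        simp only [Finset.prod_const, Finset.card_univ, Fintype.card_fin, mul_pow,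
          ← Finset.sum_div, ← Finset.mul_sum]
        ring_nf

lemma integral_uniformOfFintype {ι : Type*} [Fintype ι] [Nonempty ι] [MeasurableSpace ι]
    [MeasurableSingletonClass ι] (f : ι → ℝ) :
    ∫ e, f e ∂(PMF.uniformOfFintype ι).toMeasure = (∑ e, f e) / Fintype.card ι := by
  rw [PMF.integral_eq_sum, Finset.sum_div]
  refine Finset.sum_congr rfl fun e _ => ?_
  simp [div_eq_inv_mul]

/-- Realizing the signs on their own finite probability space lets the maximal inequality act on
frozen data, so `Ω` need not be enlarged by Rademacher variables. -/
lemma hasSubgaussianMGF_sum_sgn {n : ℕ} (a : Fin n → ℝ) :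
    HasSubgaussianMGF (fun e : Fin n → Bool => ∑ i, sgn (e i) * a i) (∑ i, a i ^ 2).toNNReal
      (PMF.uniformOfFintype (Fin n → Bool)).toMeasure where
  integrable_exp_mul t := Integrable.of_finite
  mgf_le t := by
    rw [mgf, integral_uniformOfFintype, Real.coe_toNNReal _ (by positivity),
      div_le_iff₀ (by positivity), mul_comm (Real.exp _)]
    simpa using sum_exp_sgn_le a t

/-- The average over all signs of the maximum of `N` signed sums. -/
theorem sum_pi_norm_sgn_le {n : ℕ} {ι : Type*} [Fintype ι] [Nonempty ι] (a : ι → Fin n → ℝ)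
    {s N : ℝ} (hs : 0 ≤ s) (hcard : (Fintype.card ι : ℝ) ≤ N) (ha : ∀ q, ∑ i, a q i ^ 2 ≤ s ^ 2) :
    ∑ e : Fin n → Bool, ‖fun q => ∑ i, sgn (e i) * a q i‖ ≤
      2 ^ n * (s * Real.sqrt (2 * Real.log (2 * N))) := by
  have h := integral_pi_norm_le (P := (PMF.uniformOfFintype (Fin n → Bool)).toMeasure)
    (X := fun q e => ∑ i, sgn (e i) * a q i) hs hcard fun q =>
      hasSubgaussianMGF_mono (hasSubgaussianMGF_sum_sgn (a q)) (Real.toNNReal_le_toNNReal (ha q))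
  rw [integral_uniformOfFintype, div_le_iff₀ (by positivity)] at h
  simpa [mul_comm] using h

end Signs

/-! ### Symmetrization -/

section Symmetrization

variable {Ω : Type*} [MeasurableSpace Ω] {P : Measure Ω} [IsProbabilityMeasure P]
  {E : Type*} [NormedAddCommGroup E] [NormedSpace ℝ E] [CompleteSpace E] [MeasurableSpace E]
  [BorelSpace E] [SecondCountableTopology E]

/-- Jensen's inequality in the independent variable: `‖x‖ = ‖𝔼 (x + Y)‖ ≤ 𝔼 ‖x + Y‖` for fixed `x`,
which is then integrated against the law of `X`. -/
lemma integral_norm_le_integral_norm_add {X Y : Ω → E} (hXY : IndepFun X Y P)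
    (hX : Integrable X P) (hY : Integrable Y P) (hmX : Measurable X) (hmY : Measurable Y)
    (hY0 : ∫ ω, Y ω ∂P = 0) : ∫ ω, ‖X ω‖ ∂P ≤ ∫ ω, ‖X ω + Y ω‖ ∂P := by
  have hmap := (indepFun_iff_map_prod_eq_prod_map_map hmX.aemeasurable hmY.aemeasurable).1 hXY
  have : IsProbabilityMeasure (P.map X) := Measure.isProbabilityMeasure_map hmX.aemeasurable
  have : IsProbabilityMeasure (P.map Y) := Measure.isProbabilityMeasure_map hmY.aemeasurable
  have hadd : StronglyMeasurable fun z : E × E => ‖z.1 + z.2‖ :=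
    (continuous_fst.add continuous_snd).norm.stronglyMeasurable
  have hint : Integrable (fun z : E × E => ‖z.1 + z.2‖) ((P.map X).prod (P.map Y)) := by
    rw [← hmap, integrable_map_measure hadd.aestronglyMeasurable (hmX.prodMk hmY).aemeasurable]
    exact (hX.add hY).norm
  have hidY : Integrable (fun y : E => y) (P.map Y) :=
    (integrable_map_measure aestronglyMeasurable_id hmY.aemeasurable).2 hY
  have hidX : Integrable (fun y : E => y) (P.map X) :=
    (integrable_map_measure aestronglyMeasurable_id hmX.aemeasurable).2 hX
  have h0 : ∫ y, y ∂(P.map Y) = 0 := by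
    exact (integral_map hmY.aemeasurable aestronglyMeasurable_id).trans hY0
  calc ∫ ω, ‖X ω‖ ∂P = ∫ x, ‖x‖ ∂(P.map X) := by
        rw [integral_map hmX.aemeasurable continuous_norm.aestronglyMeasurable]
    _ ≤ ∫ x, ∫ y, ‖x + y‖ ∂(P.map Y) ∂(P.map X) := by
        refine integral_mono hidX.norm hint.integral_prod_left fun x => ?_
        have h := norm_integral_le_integral_norm (μ := P.map Y) (fun y => x + y)
        rw [integral_add (integrable_const _) hidY, h0] at h
        simpa using h
    _ = ∫ z, ‖z.1 + z.2‖ ∂((P.map X).prod (P.map Y)) := (integral_prod _ hint).symm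
    _ = ∫ ω, ‖X ω + Y ω‖ ∂P := by
        rw [← hmap, integral_map (hmX.prodMk hmY).aemeasurable hadd.aestronglyMeasurable]

/-- Inserting arbitrary deterministic signs into a sum of independent centered vectors decreases
its expected norm by a factor of two at most. -/
theorem integral_norm_sum_le_two_mul_sgn {n : ℕ} {X : Fin n → Ω → E} (hind : iIndepFun X P)
    (hm : ∀ i, Measurable (X i)) (hint : ∀ i, Integrable (X i) P)
    (h0 : ∀ i, ∫ ω, X i ω ∂P = 0) (e : Fin n → Bool) :
    ∫ ω, ‖∑ i, X i ω‖ ∂P ≤ 2 * ∫ ω, ‖∑ i, sgn (e i) • X i ω‖ ∂P := by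
  classical
  -- The partial sums over the positive and the negative signs are independent and centered. Each is
  -- dominated in mean norm by the signed sum, since adding an independent centered vector does not
  -- decrease the mean norm; the triangle inequality then gives the factor 2. No independent copy of
  -- the sample is needed.
  set A : Finset (Fin n) := Finset.univ.filter fun i => e i = true with hA
  set U : Finset (Fin n) → Ω → E := fun B ω => ∑ i ∈ B, X i ω with hU
  have hmU : ∀ B, Measurable (U B) := fun B => Finset.measurable_fun_sum _ fun i _ => hm i
  have hiU : ∀ B, Integrable (U B) P := fun B => integrable_finsetSum _ fun i _ => hint i
  have h0U : ∀ B, ∫ ω, U B ω ∂P = 0 := fun B => by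
    simp only [hU]
    rw [integral_finsetSum _ fun i _ => hint i]
    exact Finset.sum_eq_zero fun i _ => h0 i
  have hindU : ∀ B C, Disjoint B C → IndepFun (U B) (U C) P := by
    intro B C hBC
    have h := hind.indepFun_finset B C hBC hm
    have h2 := h.comp (φ := fun f : B → E => ∑ i, f i) (ψ := fun f : C → E => ∑ i, f i)
      (Finset.measurable_fun_sum _ fun i _ => measurable_pi_apply i)
      (Finset.measurable_fun_sum _ fun i _ => measurable_pi_apply i)
    convert h2 using 1
    · ext ω; simp only [hU, Function.comp]; rw [← Finset.sum_coe_sort]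
    · ext ω; simp only [hU, Function.comp]; rw [← Finset.sum_coe_sort]
  have hdisj : Disjoint A Aᶜ := disjoint_compl_right
  have hsum : ∀ ω, ∑ i, X i ω = U A ω + U Aᶜ ω := fun ω =>
    (Finset.sum_add_sum_compl A _).symm
  have hsgn : ∀ ω, ∑ i, sgn (e i) • X i ω = U A ω + -U Aᶜ ω := fun ω => by
    rw [← Finset.sum_add_sum_compl A]
    simp only [hU]
    rw [← Finset.sum_neg_distrib]
    congr 1
    · refine Finset.sum_congr rfl fun i hi => ?_
      have : e i = true := by simpa [hA] using hi
      simp [sgn, this]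
    · refine Finset.sum_congr rfl fun i hi => ?_
      have : e i = false := by simpa [hA] using hi
      simp [sgn, this]
  have h1 : ∫ ω, ‖U A ω‖ ∂P ≤ ∫ ω, ‖∑ i, sgn (e i) • X i ω‖ ∂P := by
    simp_rw [hsgn]
    refine integral_norm_le_integral_norm_add (X := U A) (Y := fun ω => - U Aᶜ ω)
      ((hindU _ _ hdisj).comp measurable_id measurable_neg) (hiU _) (hiU _).neg (hmU _)
      (hmU _).neg ?_
    rw [integral_neg, h0U, neg_zero]
  have h2 : ∫ ω, ‖U Aᶜ ω‖ ∂P ≤ ∫ ω, ‖∑ i, sgn (e i) • X i ω‖ ∂P := by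
    simp_rw [hsgn]
    have := integral_norm_le_integral_norm_add (X := fun ω => - U Aᶜ ω) (Y := U A)
      ((hindU _ _ hdisj.symm).comp measurable_neg measurable_id) (hiU _).neg (hiU _) (hmU _).neg
      (hmU _) (h0U _)
    simpa [add_comm] using this
  calc ∫ ω, ‖∑ i, X i ω‖ ∂P ≤ ∫ ω, (‖U A ω‖ + ‖U Aᶜ ω‖) ∂P := by
        refine integral_mono (integrable_finsetSum _ fun i _ => hint i).norm
          ((hiU _).norm.add (hiU _).norm) fun ω => ?_
        simp only [hsum]
        exact norm_add_le _ _
    _ = ∫ ω, ‖U A ω‖ ∂P + ∫ ω, ‖U Aᶜ ω‖ ∂P := integral_add (hiU _).norm (hiU _).norm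
    _ ≤ _ := by linarith

/-- Symmetrization by averaging over all signs. -/
theorem integral_norm_sum_le_sum_sgn {n : ℕ} {X : Fin n → Ω → E} (hind : iIndepFun X P)
    (hm : ∀ i, Measurable (X i)) (hint : ∀ i, Integrable (X i) P)
    (h0 : ∀ i, ∫ ω, X i ω ∂P = 0) {B : Ω → ℝ} (hB : Integrable B P)
    (hle : ∀ ω, ∑ e : Fin n → Bool, ‖∑ i, sgn (e i) • X i ω‖ ≤ 2 ^ n * B ω) :
    ∫ ω, ‖∑ i, X i ω‖ ∂P ≤ 2 * ∫ ω, B ω ∂P := by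
  have hi : ∀ e : Fin n → Bool, Integrable (fun ω => ‖∑ i, sgn (e i) • X i ω‖) P := fun e =>
    (integrable_finsetSum _ fun i _ => (hint i).smul (sgn (e i))).norm
  -- The left side does not depend on the signs, so summing over them only multiplies it by `2 ^ n`.
  have h1 : ∑ _e : Fin n → Bool, ∫ ω, ‖∑ i, X i ω‖ ∂P ≤
      ∑ e : Fin n → Bool, 2 * ∫ ω, ‖∑ i, sgn (e i) • X i ω‖ ∂P :=
    Finset.sum_le_sum fun e _ => integral_norm_sum_le_two_mul_sgn hind hm hint h0 e
  rw [← Finset.mul_sum, ← integral_finsetSum _ fun e _ => hi e] at h1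
  have h2 : ∫ ω, ∑ e : Fin n → Bool, ‖∑ i, sgn (e i) • X i ω‖ ∂P ≤ ∫ ω, 2 ^ n * B ω ∂P :=
    integral_mono (integrable_finsetSum _ fun e _ => hi e) (hB.const_mul _) hle
  rw [integral_const_mul] at h2
  simp only [Finset.sum_const, Finset.card_univ, Fintype.card_pi, Fintype.card_bool,
    Finset.prod_const, Fintype.card_fin, nsmul_eq_mul, Nat.cast_pow, Nat.cast_ofNat] at h1
  have h3 : (2 : ℝ) ^ n * ∫ ω, ‖∑ i, X i ω‖ ∂P ≤ 2 ^ n * (2 * ∫ ω, B ω ∂P) := by linarith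
  exact le_of_mul_le_mul_left h3 (by positivity)

end Symmetrization

/-! ### Bias -/

section Bias

variable {d : ℕ}

lemma uniqueDiffOn_cube : UniqueDiffOn ℝ (cube d) := by
  have h : cube d = Set.univ.pi fun _ : Fin d => Set.Icc (0 : ℝ) 1 := by
    rw [Set.pi_univ_Icc]; rfl
  rw [h]
  exact UniqueDiffOn.univ_pi fun _ => uniqueDiffOn_Icc zero_lt_one

lemma segment_mem_cube (x y : cube d) {t : ℝ} (ht : t ∈ Set.Icc (0 : ℝ) 1) :
    x.1 + t • (y.1 - x.1) ∈ cube d :=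
  (convex_Icc (0 : Fin d → ℝ) 1).add_smul_sub_mem x.2 y.2 ht

/-- The `r`-th derivative in direction `v`, in terms of partial derivatives. -/
lemma iteratedFDerivWithin_cube_apply (f : (Fin d → ℝ) → ℝ) (r : ℕ) (x v : Fin d → ℝ) :
    iteratedFDerivWithin ℝ r f (cube d) x (fun _ => v) =
      ∑ s : Fin r → Fin d, (∏ i, v (s i)) * partialDeriv f s x := by
  have hv : v = ∑ k, v k • (Pi.single k (1 : ℝ) : Fin d → ℝ) := by
    simpa using (pi_eq_sum_univ' v)
  conv_lhs => rw [hv]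
  rw [ContinuousMultilinearMap.map_sum]
  refine Finset.sum_congr rfl fun s _ => ?_
  rw [ContinuousMultilinearMap.map_smul_univ]
  rfl

/-- By the chain rule, each further derivative along the segment inserts one more copy of the
direction `y - x`. This reduces Taylor's formula on the cube to dimension one. -/
lemma iteratedDerivWithin_segment {f : (Fin d → ℝ) → ℝ} {l : ℕ} (hf : ContDiffOn ℝ l f (cube d))
    (x y : cube d) {r : ℕ} (hr : r ≤ l) {t : ℝ} (ht : t ∈ Set.Icc (0 : ℝ) 1) :
    iteratedDerivWithin r (fun u : ℝ => f (x.1 + u • (y.1 - x.1))) (Set.Icc 0 1) t =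
      iteratedFDerivWithin ℝ r f (cube d) (x.1 + t • (y.1 - x.1)) (fun _ => y.1 - x.1) := by
  induction r generalizing t with
  | zero => simp
  | succ r ih =>
    rw [iteratedDerivWithin_succ, derivWithin_congr (fun u hu => ih (by omega) hu)
      (ih (by omega) ht)]
    have hd : HasFDerivWithinAt (iteratedFDerivWithin ℝ r f (cube d))
        (fderivWithin ℝ (iteratedFDerivWithin ℝ r f (cube d)) (cube d)
          (x.1 + t • (y.1 - x.1))) (cube d) (x.1 + t • (y.1 - x.1)) :=
      (hf.differentiableOn_iteratedFDerivWithin (by exact_mod_cast hr) uniqueDiffOn_cube _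
        (segment_mem_cube x y ht)).hasFDerivWithinAt
    have hline : HasDerivWithinAt (fun u : ℝ => x.1 + u • (y.1 - x.1)) (y.1 - x.1)
        (Set.Icc 0 1) t := by
      simpa using (((hasDerivAt_id t).smul_const (y.1 - x.1)).const_add x.1).hasDerivWithinAt
    have h1 := hd.comp_hasDerivWithinAt t hline fun u hu => segment_mem_cube x y hu
    have h2 := ((ContinuousMultilinearMap.apply ℝ (fun _ : Fin r => Fin d → ℝ) ℝ
      (fun _ => y.1 - x.1)).hasFDerivAt).comp_hasDerivWithinAt t h1
    have h3 := h2.derivWithin (uniqueDiffOn_Icc zero_lt_one t ht)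
    rw [iteratedFDerivWithin_succ_apply_left]
    exact h3

lemma abs_partialDeriv_sub_le {f : (Fin d → ℝ) → ℝ} {α L : ℝ} (hL : 0 < L)
    (hf : f ∈ HolderClass (d := d) α L) (s : Fin (strictFloor α) → Fin d) (x y : cube d) :
    |partialDeriv f s x - partialDeriv f s y| ≤ L * ‖x.1 - y.1‖ ^ (α - strictFloor α) := by
  by_cases hxy : x = y
  · subst hxy
    simp only [sub_self, abs_zero]
    positivity
  have h1 : ‖partialDeriv f s x - partialDeriv f s y‖ₑ /
      ENNReal.ofReal (‖(x : Fin d → ℝ) - y‖ ^ (α - strictFloor α)) ≤ ENNReal.ofReal L := by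
    refine le_trans ?_ ((le_add_left le_rfl).trans hf.2)
    exact le_iSup_of_le s (le_iSup_of_le x (le_iSup_of_le y (le_iSup_of_le hxy le_rfl)))
  have hpos : 0 < ‖(x : Fin d → ℝ) - y‖ ^ (α - strictFloor α) :=
    Real.rpow_pos_of_pos (norm_pos_iff.2 (sub_ne_zero.2 fun h => hxy (Subtype.ext h))) _
  rw [ENNReal.div_le_iff (by simpa using hpos) ENNReal.ofReal_ne_top,
    ← ENNReal.ofReal_mul hL.le, ← ofReal_norm,
    ENNReal.ofReal_le_ofReal_iff (by positivity)] at h1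
  exact h1

lemma strictFloor_lt {α : ℝ} (hα : 0 < α) : (strictFloor α : ℝ) < α := by
  have h1 : 0 < ⌈α⌉₊ := Nat.ceil_pos.2 hα
  have h2 := Nat.ceil_lt_add_one hα.le
  have h3 : (strictFloor α : ℝ) = (⌈α⌉₊ : ℝ) - 1 := by
    rw [strictFloor, Nat.cast_sub h1]; simp
  linarith

/-- Taylor's formula on the cube, with the remainder in Lagrange form. -/
lemma exists_taylor_cube {f : (Fin d → ℝ) → ℝ} {l : ℕ} (hf : ContDiffOn ℝ l f (cube d))
    (x y : cube d) : ∃ ξ ∈ Set.Icc (0 : ℝ) 1, f y =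
      ∑ r ∈ Finset.range l, ((r.factorial : ℝ))⁻¹ *
        ∑ s : Fin r → Fin d, (∏ i, (y.1 (s i) - x.1 (s i))) * partialDeriv f s x +
      ((l.factorial : ℝ))⁻¹ * ∑ s : Fin l → Fin d,
        (∏ i, (y.1 (s i) - x.1 (s i))) * partialDeriv f s (x.1 + ξ • (y.1 - x.1)) := by
  rcases l with _ | m
  -- Order zero has no polynomial part: the formula reads `f y = f (x + 1 • (y - x))`.
  · refine ⟨1, Set.right_mem_Icc.2 zero_le_one, ?_⟩
    simp [partialDeriv]
  set g : ℝ → ℝ := fun u : ℝ => f (x.1 + u • (y.1 - x.1)) with hg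
  have huIcc : Set.uIcc (0 : ℝ) 1 = Set.Icc 0 1 := Set.uIcc_of_le zero_le_one
  have hgC : ContDiffOn ℝ (m + 1 : ℕ) g (Set.Icc 0 1) :=
    hf.comp (t := cube d) (by fun_prop) fun u hu => segment_mem_cube x y hu
  have hder : ∀ r ≤ m + 1, ∀ t ∈ Set.Icc (0 : ℝ) 1, iteratedDerivWithin r g (Set.Icc 0 1) t =
      ∑ s : Fin r → Fin d,
        (∏ i, (y.1 (s i) - x.1 (s i))) * partialDeriv f s (x.1 + t • (y.1 - x.1)) :=
    fun r hr t ht => by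
      rw [iteratedDerivWithin_segment hf x y hr ht, iteratedFDerivWithin_cube_apply]
      rfl
  obtain ⟨ξ, hξ, h⟩ := taylor_mean_remainder_lagrange (f := g) (x := 1) (x₀ := 0) (n := m)
    zero_ne_one (by rw [huIcc]; exact hgC.of_le (by exact_mod_cast Nat.le_succ m)) (by
      rw [huIcc, Set.uIoo_of_le zero_le_one]
      exact (hgC.differentiableOn_iteratedDerivWithin (by exact_mod_cast Nat.lt_succ_self m)
        (uniqueDiffOn_Icc zero_lt_one)).mono Set.Ioo_subset_Icc_self)
  rw [Set.uIoo_of_le zero_le_one] at hξ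
  have hξ' := Set.Ioo_subset_Icc_self hξ
  refine ⟨ξ, hξ', ?_⟩
  rw [huIcc, taylor_within_apply, hder _ le_rfl ξ hξ', sub_eq_iff_eq_add'] at h
  have hg1 : g 1 = f y := by simp [hg]
  rw [hg1] at h
  rw [h]
  congr 1
  · refine Finset.sum_congr rfl fun r hr => ?_
    rw [hder r (by simp at hr; omega) 0 (Set.left_mem_Icc.2 zero_le_one)]
    simp
  · simp [div_eq_inv_mul]

/-- Taylor expansion of a Hölder function on the cube. -/
lemma abs_taylor_remainder_le {f : (Fin d → ℝ) → ℝ} {α L : ℝ} (hα : 0 < α) (hL : 0 < L)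
    (hf : f ∈ HolderClass (d := d) α L) (x y : cube d) :
    |f y - ∑ r ∈ Finset.range (strictFloor α + 1), ((r.factorial : ℝ))⁻¹ *
        ∑ s : Fin r → Fin d, (∏ i, (y.1 (s i) - x.1 (s i))) * partialDeriv f s x| ≤
      d ^ strictFloor α * L * ‖y.1 - x.1‖ ^ α := by
  set l := strictFloor α with hl
  have hlα : (l : ℝ) < α := strictFloor_lt hα
  set v := y.1 - x.1 with hv
  -- Completing the Taylor polynomial by its top-degree part at `x` leaves the difference of the
  -- top-order derivatives at `x + ξ • v` and at `x`, where Hölder continuity applies. The factor `d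
  -- ^ l` counts the tuples `s`.
  have htop : ∀ ξ ∈ Set.Icc (0 : ℝ) 1, ∀ hξ : x.1 + ξ • v ∈ cube d,
      |∑ s : Fin l → Fin d, (∏ i, v (s i)) * partialDeriv f s (x.1 + ξ • v) -
        ∑ s : Fin l → Fin d, (∏ i, v (s i)) * partialDeriv f s x| ≤
      d ^ l * L * ‖v‖ ^ α := by
    intro ξ hξ hmem
    rw [← Finset.sum_sub_distrib]
    refine (Finset.abs_sum_le_sum_abs _ _).trans ?_
    calc _ ≤ ∑ _s : Fin l → Fin d, L * ‖v‖ ^ α := by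
          refine Finset.sum_le_sum fun s _ => ?_
          rw [← mul_sub, abs_mul, Finset.abs_prod]
          have h1 : ∏ i, |v (s i)| ≤ ‖v‖ ^ l := by
            calc ∏ i, |v (s i)| ≤ ∏ _i : Fin l, ‖v‖ :=
                  Finset.prod_le_prod (fun _ _ => abs_nonneg _) fun i _ => norm_le_pi_norm v (s i)
              _ = ‖v‖ ^ l := by simp
          have h2 : |partialDeriv f s (x.1 + ξ • v) - partialDeriv f s x| ≤
              L * ‖v‖ ^ (α - l) := by
            refine (abs_partialDeriv_sub_le hL hf s ⟨_, hmem⟩ x).trans ?_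
            have h3 : ‖x.1 + ξ • v - x.1‖ ≤ ‖v‖ := by
              rw [add_sub_cancel_left, norm_smul, Real.norm_of_nonneg hξ.1]
              exact mul_le_of_le_one_left (norm_nonneg _) hξ.2
            have : 0 ≤ α - l := by linarith
            gcongr
          calc _ ≤ ‖v‖ ^ l * (L * ‖v‖ ^ (α - l)) := by gcongr
            _ = L * (‖v‖ ^ (l : ℝ) * ‖v‖ ^ (α - l)) := by rw [Real.rpow_natCast]; ring
            _ = L * ‖v‖ ^ α := by
              rw [← Real.rpow_add_of_nonneg (norm_nonneg _) (Nat.cast_nonneg _) (by linarith)]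
              congr 2; ring
      _ = d ^ l * L * ‖v‖ ^ α := by simp [mul_assoc]
  obtain ⟨ξ, hξ, h⟩ := exists_taylor_cube hf.1 x y
  rw [Finset.sum_range_succ, h, add_sub_add_left_eq_sub, ← mul_sub, abs_mul]
  refine (mul_le_of_le_one_left (abs_nonneg _) ?_).trans
    (htop ξ hξ (segment_mem_cube x y hξ))
  rw [abs_of_nonneg (by positivity)]
  exact inv_le_one_of_one_le₀ (by exact_mod_cast Nat.one_le_iff_ne_zero.2 l.factorial_ne_zero)

/-! ### Weights -/

variable {p : Fin d → ℕ} {D : ProductDesign p} {C₁ C₂ C₃ h : ℝ} {γ : ℕ} {w : Idx p → cube d → ℝ}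

/-- Sums over the design points of quantities vanishing outside of a box. -/
lemma sum_le_of_vanish {x : cube d}
    (hcard : (Nat.card {j : Idx p //
      ∀ k, x.1 k - h ≤ (D.pt j).1 k ∧ (D.pt j).1 k ≤ x.1 k + h} : ℝ) ≤ C₃ * h ^ d * pProd p)
    (hh : 0 < h) {f : Idx p → ℝ} {b : ℝ} (hb : 0 ≤ b) (hle : ∀ j, f j ≤ b)
    (hf : ∀ j, h < ‖((D.pt j : cube d) : Fin d → ℝ) - x‖ → f j = 0) :
    ∑ j, f j ≤ b * (C₃ * h ^ d * pProd p) := by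
  classical
  set B : Finset (Idx p) := Finset.univ.filter fun j =>
    ∀ k, x.1 k - h ≤ (D.pt j).1 k ∧ (D.pt j).1 k ≤ x.1 k + h with hB
  have hcardB : (B.card : ℝ) ≤ C₃ * h ^ d * pProd p := by
    rw [Nat.card_eq_fintype_card, Fintype.card_subtype] at hcard
    exact hcard
  have hout : ∀ j ∉ B, f j = 0 := by
    intro j hj
    refine hf j (lt_of_not_ge fun hle => hj ?_)
    rw [pi_norm_le_iff_of_nonneg hh.le] at hle
    simp only [hB, Finset.mem_filter, Finset.mem_univ, true_and]
    intro k
    have := abs_le.1 (hle k)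
    simp only [Pi.sub_apply] at this
    constructor <;> linarith [this.1, this.2]
  calc ∑ j, f j = ∑ j ∈ B, f j :=
        (Finset.sum_subset (Finset.subset_univ B) fun j _ hj => hout j hj).symm
    _ ≤ ∑ _j ∈ B, b := Finset.sum_le_sum fun j _ => hle j
    _ = b * B.card := by simp [mul_comm]
    _ ≤ _ := by gcongr

/-- At most `C₃ h^d p^𝟏` weights are nonzero, each of size at most `C₁ / (p^𝟏 h^d)`. This stability
constant carries bounds at the design points over to the estimator. -/
lemma sum_abs_weight_le (hw : WeightConditions D γ C₁ C₂ h w)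
    (hcard : ∀ x : cube d, (Nat.card {j : Idx p //
      ∀ k, x.1 k - h ≤ (D.pt j).1 k ∧ (D.pt j).1 k ≤ x.1 k + h} : ℝ) ≤ C₃ * h ^ d * pProd p)
    (hh : 0 < h) (hC₁ : 0 < C₁) (hp : 0 < pProd p) (x : cube d) :
    ∑ j, |w j x| ≤ C₁ * C₃ := by
  have hp' : (0 : ℝ) < pProd p := by exact_mod_cast hp
  refine (sum_le_of_vanish (hcard x) hh (b := C₁ / (pProd p * h ^ d)) (by positivity)
    (fun j => hw.abs_le j x) fun j hj => by rw [hw.vanish j x hj, abs_zero]).trans_eq ?_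
  field_simp

/-- The same count of nonzero weights; the factor `1 / (p^𝟏 h^d)` that remains is the variance
reduction due to local averaging of the errors. -/
lemma sum_sq_weight_le (hw : WeightConditions D γ C₁ C₂ h w)
    (hcard : ∀ x : cube d, (Nat.card {j : Idx p //
      ∀ k, x.1 k - h ≤ (D.pt j).1 k ∧ (D.pt j).1 k ≤ x.1 k + h} : ℝ) ≤ C₃ * h ^ d * pProd p)
    (hh : 0 < h) (hC₁ : 0 < C₁) (hp : 0 < pProd p) (x : cube d) :
    ∑ j, w j x ^ 2 ≤ C₁ ^ 2 * C₃ / (pProd p * h ^ d) := by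
  have hp' : (0 : ℝ) < pProd p := by exact_mod_cast hp
  refine (sum_le_of_vanish (hcard x) hh (b := (C₁ / (pProd p * h ^ d)) ^ 2) (by positivity)
    (fun j => ?_) fun j hj => by rw [hw.vanish j x hj]; simp).trans_eq ?_
  · rw [← sq_abs]
    have := hw.abs_le j x
    gcongr
  · field_simp

/-- The weights annihilate the non-constant monomials indexed by `s`. -/
lemma sum_prod_weight_eq_zero (hw : WeightConditions D γ C₁ C₂ h w) {r : ℕ} (hr : 1 ≤ r)
    (hrγ : r ≤ γ) (s : Fin r → Fin d) (x : cube d) :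
    ∑ j, w j x * ∏ i, ((D.pt j).1 (s i) - x.1 (s i)) = 0 := by
  classical
  have hsum : ∑ k, (Finset.univ.filter fun i => s i = k).card = r := by
    simpa using (Finset.card_eq_sum_card_fiberwise (f := s) (s := Finset.univ) (t := Finset.univ)
      (by simp)).symm
  -- The multi-index of `s` records its fibre sizes, that is, how often each coordinate occurs.
  have h := hw.sum_monomial (fun k => (Finset.univ.filter fun i => s i = k).card)
    (by rw [hsum]; exact hr) (by rw [hsum]; exact hrγ) x
  rw [← h]
  refine Finset.sum_congr rfl fun j _ => ?_
  rw [mul_comm]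
  congr 1
  rw [← Finset.prod_fiberwise' Finset.univ s fun k => (D.pt j).1 k - x.1 k]
  simp

/-- The bias of the linear estimator. -/
theorem abs_bias_le {f : (Fin d → ℝ) → ℝ} {α L : ℝ} (hα : 0 < α) (hL : 0 < L)
    (hf : f ∈ HolderClass (d := d) α L) (hw : WeightConditions D (strictFloor α) C₁ C₂ h w)
    (hcard : ∀ x : cube d, (Nat.card {j : Idx p //
      ∀ k, x.1 k - h ≤ (D.pt j).1 k ∧ (D.pt j).1 k ≤ x.1 k + h} : ℝ) ≤ C₃ * h ^ d * pProd p)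
    (hh : 0 < h) (hC₁ : 0 < C₁) (hp : 0 < pProd p) (x : cube d) :
    |∑ j, w j x * f (D.pt j) - f x| ≤ C₁ * C₃ * (d ^ strictFloor α * L) * h ^ α := by
  set l := strictFloor α with hl
  set Q : Idx p → ℝ := fun j => ∑ r ∈ Finset.range (l + 1), ((r.factorial : ℝ))⁻¹ *
    ∑ s : Fin r → Fin d, (∏ i, ((D.pt j).1 (s i) - x.1 (s i))) * partialDeriv f s x with hQ
  -- `Q` is the Taylor polynomial at `x` evaluated at the design points; the weights annihilate all
  -- its terms except the constant one, `f x`.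
  have hQsum : ∑ j, w j x * Q j = f x := by
    have h1 : ∀ r ∈ Finset.range (l + 1), ∑ j, w j x * (((r.factorial : ℝ))⁻¹ *
        ∑ s : Fin r → Fin d, (∏ i, ((D.pt j).1 (s i) - x.1 (s i))) * partialDeriv f s x) =
        if r = 0 then f x else 0 := by
      intro r hr
      split_ifs with h0
      · subst h0
        simp [partialDeriv, ← Finset.sum_mul, hw.sum_eq_one]
      · have h2 : ∀ j, w j x * (((r.factorial : ℝ))⁻¹ *
            ∑ s : Fin r → Fin d, (∏ i, ((D.pt j).1 (s i) - x.1 (s i))) * partialDeriv f s x) =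
            ∑ s : Fin r → Fin d, ((r.factorial : ℝ))⁻¹ * partialDeriv f s x *
              (w j x * ∏ i, ((D.pt j).1 (s i) - x.1 (s i))) := fun j => by
          rw [Finset.mul_sum, Finset.mul_sum]
          exact Finset.sum_congr rfl fun s _ => by ring
        simp_rw [h2]
        rw [Finset.sum_comm]
        refine Finset.sum_eq_zero fun s _ => ?_
        rw [← Finset.mul_sum, sum_prod_weight_eq_zero hw (by omega) (by simp at hr; omega),
          mul_zero]
    simp only [hQ, Finset.mul_sum (Finset.range (l + 1))]
    rw [Finset.sum_comm, Finset.sum_congr rfl h1]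
    simp
  have hdiff : ∑ j, w j x * f (D.pt j) - f x = ∑ j, w j x * (f (D.pt j) - Q j) := by
    rw [← hQsum, ← Finset.sum_sub_distrib]
    exact Finset.sum_congr rfl fun j _ => by ring
  rw [hdiff]
  calc |∑ j, w j x * (f (D.pt j) - Q j)| ≤ ∑ j, |w j x * (f (D.pt j) - Q j)| :=
        Finset.abs_sum_le_sum_abs _ _
    _ ≤ ∑ j, |w j x| * (d ^ l * L * h ^ α) := by
        refine Finset.sum_le_sum fun j _ => ?_
        by_cases hj : h < ‖((D.pt j : cube d) : Fin d → ℝ) - x‖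
        · simp [hw.vanish j x hj]
        · rw [abs_mul]
          have h1 := abs_taylor_remainder_le hα hL hf x (D.pt j)
          have h2 : ‖(D.pt j).1 - x.1‖ ^ α ≤ h ^ α := by
            have := not_lt.1 hj
            gcongr
          refine mul_le_mul_of_nonneg_left (h1.trans ?_) (abs_nonneg _)
          gcongr
    _ = (∑ j, |w j x|) * (d ^ l * L * h ^ α) := by rw [Finset.sum_mul]
    _ ≤ C₁ * C₃ * (d ^ l * L * h ^ α) := by
        have := sum_abs_weight_le hw hcard hh hC₁ hp x
        gcongr
    _ = _ := by ring

end Bias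

/-! ### Grids -/

section Grid

variable {d : ℕ}

/-- The point `q / m` of the regular grid of mesh `1 / m`. -/
noncomputable def gridPt (m : ℕ) (q : Fin d → Fin (m + 1)) : cube d :=
  ⟨fun k => ((q k : ℕ) : ℝ) / m, fun _ => by simp only [Pi.zero_apply]; positivity, fun k =>
    div_le_one_of_le₀ (Nat.cast_le.2 (Nat.lt_succ_iff.1 (q k).2)) (Nat.cast_nonneg m)⟩

/-- The index of the grid point obtained by rounding down. -/
noncomputable def gridIdx (m : ℕ) (x : cube d) (k : Fin d) : Fin (m + 1) :=
  ⟨⌊m * x.1 k⌋₊, Nat.lt_succ_iff.2 <| Nat.floor_le_of_le <|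
    mul_le_of_le_one_right (Nat.cast_nonneg m) (x.2.2 k)⟩

lemma norm_sub_gridPt_le {m : ℕ} (hm : 0 < m) (x : cube d) :
    ‖x.1 - (gridPt m (gridIdx m x)).1‖ ≤ 1 / m := by
  have hm' : (0 : ℝ) < m := by exact_mod_cast hm
  rw [pi_norm_le_iff_of_nonneg (by positivity)]
  intro k
  have h0 : 0 ≤ m * x.1 k := mul_nonneg hm'.le (x.2.1 k)
  have h1 := Nat.floor_le h0
  have h2 := Nat.lt_floor_add_one (m * x.1 k)
  have h3 : (x.1 - (gridPt m (gridIdx m x)).1) k = (m * x.1 k - ⌊m * x.1 k⌋₊) / m := by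
    simp only [gridPt, gridIdx, Pi.sub_apply]
    field_simp
  rw [h3, Real.norm_of_nonneg (div_nonneg (by linarith) hm'.le)]
  gcongr
  linarith

/-- The index of the parent in the next coarser dyadic grid. -/
def parentIdx {k : ℕ} (q : Fin d → Fin (2 ^ (k + 1) + 1)) (l : Fin d) : Fin (2 ^ k + 1) :=
  ⟨(q l : ℕ) / 2, by have := (q l).2; have := pow_succ 2 k; omega⟩

/-- Halving `⌊2^(k+1) x⌋` and rounding down gives `⌊2^k x⌋`. Hence the roundings of a point at
successive levels form a chain under `parentIdx`, and the chaining sum telescopes. -/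
lemma parentIdx_gridIdx (k : ℕ) (x : cube d) :
    parentIdx (gridIdx (2 ^ (k + 1)) x) = gridIdx (2 ^ k) x := by
  funext l
  apply Fin.ext
  simp only [parentIdx, gridIdx]
  rw [← Nat.floor_div_natCast]
  congr 1
  push_cast
  ring

lemma norm_gridPt_sub_parent_le (k : ℕ) (q : Fin d → Fin (2 ^ (k + 1) + 1)) :
    ‖(gridPt (2 ^ (k + 1)) q).1 - (gridPt (2 ^ k) (parentIdx q)).1‖ ≤ ((2 : ℝ) ^ (k + 1))⁻¹ := by
  rw [pi_norm_le_iff_of_nonneg (by positivity)]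
  intro l
  have h1 : (((q l : ℕ) / 2 : ℕ) : ℝ) * 2 ≤ (q l : ℕ) := by
    exact_mod_cast Nat.div_mul_le_self _ 2
  have h2 : ((q l : ℕ) : ℝ) ≤ (((q l : ℕ) / 2 : ℕ) : ℝ) * 2 + 1 := by
    have : (q l : ℕ) ≤ (q l : ℕ) / 2 * 2 + 1 := by omega
    exact_mod_cast this
  have h3 : ((gridPt (2 ^ (k + 1)) q).1 - (gridPt (2 ^ k) (parentIdx q)).1) l =
      (((q l : ℕ) : ℝ) - (((q l : ℕ) / 2 : ℕ) : ℝ) * 2) * ((2 : ℝ) ^ (k + 1))⁻¹ := by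
    simp only [gridPt, parentIdx, Pi.sub_apply]
    push_cast
    have h4 : (2 : ℝ) ^ (k + 1) = 2 ^ k * 2 := pow_succ 2 k
    rw [h4, div_eq_mul_inv, div_eq_mul_inv, mul_inv]
    ring
  rw [h3, Real.norm_of_nonneg (mul_nonneg (by linarith) (by positivity))]
  exact mul_le_of_le_one_left (by positivity) (by linarith)

lemma norm_sub_le_one (x y : cube d) : ‖x.1 - y.1‖ ≤ 1 := by
  rw [pi_norm_le_iff_of_nonneg zero_le_one]
  intro k
  have h1 := x.2.1 k
  have h2 := x.2.2 k
  have h3 := y.2.1 k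
  have h4 := y.2.2 k
  simp only [Pi.zero_apply, Pi.one_apply] at h1 h2 h3 h4
  rw [Pi.sub_apply, Real.norm_eq_abs, abs_le]
  constructor <;> linarith

end Grid

/-! ### Chaining -/

section Chaining

variable {d : ℕ}

/-- The contribution of the `k`-th dyadic grid to the chaining bound. -/
noncomputable def chainTerm (d : ℕ) (β : ℝ) (k : ℕ) : ℝ :=
  ((2 : ℝ) ^ k)⁻¹ ^ β * Real.sqrt (2 * Real.log (2 * ((2 : ℝ) ^ k + 1) ^ d))

lemma chainTerm_nonneg (d : ℕ) (β : ℝ) (k : ℕ) : 0 ≤ chainTerm d β k := by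
  unfold chainTerm; positivity

/-- The logarithm of the number of grid points grows only linearly in `k`, while `2^(-kβ)` decays
geometrically. -/
lemma summable_chainTerm (d : ℕ) {β : ℝ} (hβ : 0 < β) : Summable (chainTerm d β) := by
  set r : ℝ := (2 : ℝ)⁻¹ ^ β with hr
  have hr0 : 0 < r := by positivity
  have hr1 : r < 1 := Real.rpow_lt_one (by norm_num) (by norm_num) hβ
  have hs : Summable fun k : ℕ => (2 * ((d : ℝ) + 1)) * ((k : ℝ) ^ 1 * r ^ k + r ^ k) :=
    ((summable_pow_mul_geometric_of_norm_lt_one 1 (by rwa [Real.norm_of_nonneg hr0.le])).add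
      (summable_geometric_of_lt_one hr0.le hr1)).mul_left _
  refine Summable.of_nonneg_of_le (chainTerm_nonneg d β) (fun k => ?_) hs
  have h1 : ((2 : ℝ) ^ k)⁻¹ ^ β = r ^ k := by
    rw [hr, ← inv_pow, ← Real.rpow_natCast, ← Real.rpow_natCast, ← Real.rpow_mul (by norm_num),
      ← Real.rpow_mul (by norm_num), mul_comm]
  have h2 : Real.log (2 * ((2 : ℝ) ^ k + 1) ^ d) ≤ ((d : ℝ) + 1) * (k + 1) := by
    have h3 : 2 * ((2 : ℝ) ^ k + 1) ^ d ≤ 2 ^ ((d + 1) * (k + 1)) := by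
      have h4 : (2 : ℝ) ^ k + 1 ≤ 2 ^ (k + 1) := by
        have : (1 : ℝ) ≤ 2 ^ k := one_le_pow₀ (by norm_num)
        rw [pow_succ]; linarith
      calc 2 * ((2 : ℝ) ^ k + 1) ^ d ≤ 2 ^ (k + 1) * (2 ^ (k + 1)) ^ d := by
            have : (2 : ℝ) ≤ 2 ^ (k + 1) := by
              simpa using pow_le_pow_right₀ (one_le_two (α := ℝ)) (Nat.succ_le_succ (Nat.zero_le k))
            gcongr
        _ = 2 ^ ((d + 1) * (k + 1)) := by rw [← pow_mul, ← pow_add]; ring_nf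
    calc _ ≤ Real.log ((2 : ℝ) ^ ((d + 1) * (k + 1))) := Real.log_le_log (by positivity) h3
      _ = ((d : ℝ) + 1) * (k + 1) * Real.log 2 := by rw [Real.log_pow]; push_cast; ring
      _ ≤ ((d : ℝ) + 1) * (k + 1) * 1 := by
          have := Real.log_two_lt_d9
          gcongr
          linarith
      _ = _ := mul_one _
  have h5 : Real.sqrt (2 * Real.log (2 * ((2 : ℝ) ^ k + 1) ^ d)) ≤ 2 * ((d : ℝ) + 1) * (k + 1) := by
    refine Real.sqrt_le_iff.2 ⟨by positivity, ?_⟩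
    have h6 : 1 ≤ ((d : ℝ) + 1) * (k + 1) := by
      have : (0 : ℝ) ≤ d := Nat.cast_nonneg d
      have : (0 : ℝ) ≤ k := Nat.cast_nonneg k
      nlinarith [mul_nonneg ‹(0 : ℝ) ≤ d› ‹(0 : ℝ) ≤ k›]
    nlinarith
  rw [chainTerm, h1]
  calc _ ≤ r ^ k * (2 * ((d : ℝ) + 1) * (k + 1)) := by gcongr
    _ = _ := by ring

/-- The finite set of points that occurs in the chains of length `K` from the origin to the points
`pts j`. -/
noncomputable def chainSet {J : Type*} [Fintype J] (pts : J → cube d) (K : ℕ) : Finset (cube d) :=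
  open Classical in
  insert (origin d) (Finset.univ.image pts ∪
    (Finset.range (K + 1)).biUnion fun k => Finset.univ.image (gridPt (2 ^ k)))

variable {J : Type*} [Fintype J] {pts : J → cube d} {K : ℕ}

lemma origin_mem_chainSet : origin d ∈ chainSet pts K := by simp [chainSet]

lemma pts_mem_chainSet (j : J) : pts j ∈ chainSet pts K := by simp [chainSet]

lemma gridPt_mem_chainSet {k : ℕ} (hk : k ≤ K) (q : Fin d → Fin (2 ^ k + 1)) :
    gridPt (2 ^ k) q ∈ chainSet pts K := by
  classical
  simp only [chainSet, Finset.mem_insert, Finset.mem_union, Finset.mem_biUnion]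
  exact Or.inr (Or.inr ⟨k, by simpa [Nat.lt_succ_iff] using hk,
    Finset.mem_image_of_mem _ (Finset.mem_univ q)⟩)

/-- The signed sum at the grid points of level `k`, minus its value at the parents. -/
noncomputable def chainIncr {n : ℕ} (z : Fin n → cube d → ℝ) :
    (k : ℕ) → (Fin d → Fin (2 ^ k + 1)) → Fin n → ℝ
  | 0, q, i => z i (gridPt (2 ^ 0) q)
  | k + 1, q, i => z i (gridPt (2 ^ (k + 1)) q) - z i (gridPt (2 ^ k) (parentIdx q))

lemma sum_chainIncr {n : ℕ} (z : Fin n → cube d → ℝ) (K : ℕ) (x : cube d) (i : Fin n) :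
    ∑ k ∈ Finset.range (K + 1), chainIncr z k (gridIdx (2 ^ k) x) i =
      z i (gridPt (2 ^ K) (gridIdx (2 ^ K) x)) := by
  induction K with
  | zero => simp [chainIncr]
  | succ K ih =>
    rw [Finset.sum_range_succ, ih, chainIncr, parentIdx_gridIdx]
    ring

/-- The chaining bound for signed sums of Hölder functions, averaged over all signs. -/
theorem sum_sgn_chaining_le {n : ℕ} {β : ℝ} (hβ : 0 < β) (z : Fin n → cube d → ℝ) (b : Fin n → ℝ)
    (hb0 : ∀ i, 0 ≤ b i)
    (hz0 : ∀ i, ∀ u ∈ chainSet pts K, |z i u| ≤ b i)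
    (hz : ∀ i, ∀ u ∈ chainSet pts K, ∀ v ∈ chainSet pts K,
      |z i u - z i v| ≤ b i * ‖u.1 - v.1‖ ^ β)
    (hK : ((2 : ℝ) ^ K)⁻¹ ^ β * Real.sqrt n ≤ 1) :
    ∑ e : Fin n → Bool, ‖fun j => ∑ i, sgn (e i) * z i (pts j)‖ ≤
      2 ^ n * (((∑' k, chainTerm d β k) + 1) * Real.sqrt (∑ i, b i ^ 2)) := by
  set B := Real.sqrt (∑ i, b i ^ 2) with hB
  have hBsq : B ^ 2 = ∑ i, b i ^ 2 := Real.sq_sqrt (Finset.sum_nonneg fun i _ => sq_nonneg _)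
  -- The last link, from the finest grid to the point itself, is bounded without using the signs:
  -- Cauchy–Schwarz loses `√n`, which the choice of `K` compensates. Thus the number of points never
  -- enters.
  have hlast : ((2 : ℝ) ^ K)⁻¹ ^ β * ∑ i, b i ≤ B := by
    have h1 : ∑ i, b i ≤ Real.sqrt n * B := by
      rw [hB, ← Real.sqrt_mul (Nat.cast_nonneg n)]
      refine Real.le_sqrt_of_sq_le ?_
      simpa using sq_sum_le_card_mul_sum_sq (s := Finset.univ) (f := b)
    calc _ ≤ ((2 : ℝ) ^ K)⁻¹ ^ β * (Real.sqrt n * B) := by gcongr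
      _ = (((2 : ℝ) ^ K)⁻¹ ^ β * Real.sqrt n) * B := by ring
      _ ≤ 1 * B := by gcongr
      _ = B := one_mul _
  have hpt : ∀ e : Fin n → Bool, ‖fun j => ∑ i, sgn (e i) * z i (pts j)‖ ≤
      ∑ k ∈ Finset.range (K + 1), ‖fun q => ∑ i, sgn (e i) * chainIncr z k q i‖ + B := by
    intro e
    rw [pi_norm_le_iff_of_nonneg (by positivity)]
    intro j
    set g := gridPt (2 ^ K) (gridIdx (2 ^ K) (pts j)) with hg
    have h1 : ∑ i, sgn (e i) * z i (pts j) =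
        ∑ k ∈ Finset.range (K + 1), ∑ i, sgn (e i) * chainIncr z k (gridIdx (2 ^ k) (pts j)) i +
        ∑ i, sgn (e i) * (z i (pts j) - z i g) := by
      rw [Finset.sum_comm, ← Finset.sum_add_distrib]
      refine Finset.sum_congr rfl fun i _ => ?_
      rw [← Finset.mul_sum, sum_chainIncr]
      ring
    rw [h1]
    refine (norm_add_le _ _).trans (add_le_add ((norm_sum_le _ _).trans
      (Finset.sum_le_sum fun k _ => norm_le_pi_norm
        (fun q => ∑ i, sgn (e i) * chainIncr z k q i) _)) ?_)
    refine ((norm_sum_le _ _).trans (Finset.sum_le_sum (g := fun i => b i * ((2 : ℝ) ^ K)⁻¹ ^ β)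
      fun i _ => ?_)).trans ?_
    · rw [norm_mul, Real.norm_eq_abs, abs_sgn, one_mul]
      refine (hz i _ (pts_mem_chainSet j) _ (gridPt_mem_chainSet le_rfl _)).trans ?_
      have h2 := norm_sub_gridPt_le (m := 2 ^ K) (by positivity) (pts j)
      rw [one_div] at h2
      push_cast at h2
      have := hb0 i
      gcongr
    · rw [← Finset.sum_mul, mul_comm]
      exact hlast
  have hlevel : ∀ k ∈ Finset.range (K + 1),
      ∑ e : Fin n → Bool, ‖fun q => ∑ i, sgn (e i) * chainIncr z k q i‖ ≤
        2 ^ n * (chainTerm d β k * B) := by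
    intro k hk
    have hkK : k ≤ K := by simpa [Nat.lt_succ_iff] using hk
    refine (sum_pi_norm_sgn_le (fun q i => chainIncr z k q i) (s := ((2 : ℝ) ^ k)⁻¹ ^ β * B)
      (N := ((2 : ℝ) ^ k + 1) ^ d) (by positivity) (by simp) fun q => ?_).trans_eq ?_
    · rw [mul_pow, hBsq, Finset.mul_sum]
      refine Finset.sum_le_sum fun i _ => ?_
      rw [← mul_pow, ← sq_abs]
      have hbi := hb0 i
      have : |chainIncr z k q i| ≤ ((2 : ℝ) ^ k)⁻¹ ^ β * b i := by
        cases k with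
        -- Level 0 has no parent; there the values at the corners of the cube are bounded instead of
        -- increments.
        | zero => simpa [chainIncr] using hz0 i _ (gridPt_mem_chainSet hkK q)
        | succ k =>
          refine (hz i _ (gridPt_mem_chainSet hkK q) _
            (gridPt_mem_chainSet (by omega) (parentIdx q))).trans ?_
          rw [mul_comm]
          have := norm_gridPt_sub_parent_le k q
          gcongr
      gcongr
    · rw [chainTerm]; ring
  calc ∑ e : Fin n → Bool, ‖fun j => ∑ i, sgn (e i) * z i (pts j)‖
      ≤ ∑ e : Fin n → Bool,
        (∑ k ∈ Finset.range (K + 1), ‖fun q => ∑ i, sgn (e i) * chainIncr z k q i‖ + B) :=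
        Finset.sum_le_sum fun e _ => hpt e
    _ = ∑ k ∈ Finset.range (K + 1), ∑ e : Fin n → Bool,
          ‖fun q => ∑ i, sgn (e i) * chainIncr z k q i‖ + 2 ^ n * B := by
        rw [Finset.sum_add_distrib, Finset.sum_comm]
        simp
    _ ≤ ∑ k ∈ Finset.range (K + 1), 2 ^ n * (chainTerm d β k * B) + 2 ^ n * B := by
        gcongr with k hk
        exact hlevel k hk
    _ = 2 ^ n * ((∑ k ∈ Finset.range (K + 1), chainTerm d β k + 1) * B) := by
        rw [← Finset.mul_sum, ← Finset.sum_mul]; ring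
    _ ≤ _ := by
        have := (summable_chainTerm d hβ).sum_le_tsum (Finset.range (K + 1))
          fun k _ => chainTerm_nonneg d β k
        gcongr

end Chaining

/-! ### The averaged processes -/

section Fields

variable {d : ℕ}

/-- The Hölder seminorm of `z` on a finite set. -/
noncomputable def holderOn (S : Finset (cube d)) (β : ℝ) (z : cube d → ℝ) : ℝ :=
  ‖fun q : S × S => (z q.1 - z q.2) / ‖(q.1 : cube d).1 - (q.2 : cube d).1‖ ^ β‖

lemma measurable_holderOn (S : Finset (cube d)) (β : ℝ) : Measurable (holderOn S β) := by
  refine Measurable.norm (measurable_pi_lambda _ fun q => ?_)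
  exact ((measurable_pi_apply (q.1 : cube d)).sub (measurable_pi_apply (q.2 : cube d))).div_const _

lemma holderOn_nonneg (S : Finset (cube d)) (β : ℝ) (z : cube d → ℝ) : 0 ≤ holderOn S β z :=
  norm_nonneg _

lemma abs_sub_le_holderOn {S : Finset (cube d)} {β : ℝ} (z : cube d → ℝ) {u v : cube d}
    (hu : u ∈ S) (hv : v ∈ S) : |z u - z v| ≤ holderOn S β z * ‖u.1 - v.1‖ ^ β := by
  by_cases huv : u = v
  · subst huv
    simp only [sub_self, abs_zero]
    exact mul_nonneg (holderOn_nonneg _ _ _) (by positivity)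
  have hpos : 0 < ‖u.1 - v.1‖ ^ β :=
    Real.rpow_pos_of_pos (norm_pos_iff.2 (sub_ne_zero.2 fun h => huv (Subtype.ext h))) _
  have h := norm_le_pi_norm (fun q : S × S => (z q.1 - z q.2) /
    ‖(q.1 : cube d).1 - (q.2 : cube d).1‖ ^ β) (⟨u, hu⟩, ⟨v, hv⟩)
  rw [norm_div, Real.norm_of_nonneg hpos.le, div_le_iff₀ hpos] at h
  exact h

lemma holderOn_le {S : Finset (cube d)} {β M : ℝ} {z : cube d → ℝ} (hM : 0 ≤ M)
    (h : ∀ u ∈ S, ∀ v ∈ S, |z u - z v| ≤ M * ‖u.1 - v.1‖ ^ β) : holderOn S β z ≤ M := by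
  refine (pi_norm_le_iff_of_nonneg hM).2 fun q => ?_
  rw [norm_div, Real.norm_of_nonneg (r := _ ^ β) (by positivity)]
  exact div_le_of_le_mul₀ (by positivity) hM (h _ q.1.2 _ q.2.2)

/-- A bound for the values on `S` and for the Hölder seminorm on `S`. -/
noncomputable def holderBound (S : Finset (cube d)) (β : ℝ) (z : cube d → ℝ) : ℝ :=
  |z (origin d)| + holderOn S β z

lemma measurable_holderBound (S : Finset (cube d)) (β : ℝ) : Measurable (holderBound S β) :=
  (measurable_pi_apply (origin d)).abs.add (measurable_holderOn S β)

lemma holderBound_nonneg (S : Finset (cube d)) (β : ℝ) (z : cube d → ℝ) : 0 ≤ holderBound S β z :=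
  add_nonneg (abs_nonneg _) (holderOn_nonneg _ _ _)

lemma abs_le_holderBound {S : Finset (cube d)} {β : ℝ} (hβ : 0 ≤ β) (z : cube d → ℝ)
    (h0 : origin d ∈ S) {u : cube d} (hu : u ∈ S) : |z u| ≤ holderBound S β z := by
  have h1 : |z u - z (origin d)| ≤ holderOn S β z := by
    refine (abs_sub_le_holderOn z hu h0).trans
      (mul_le_of_le_one_right (holderOn_nonneg _ _ _) ?_)
    exact Real.rpow_le_one (norm_nonneg _) (norm_sub_le_one _ _) hβ
  have h2 : |z u| ≤ |z u - z (origin d)| + |z (origin d)| := by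
    simpa using abs_add_le (z u - z (origin d)) (z (origin d))
  unfold holderBound
  linarith

variable {Ω Ω' : Type*} [MeasurableSpace Ω] [MeasurableSpace Ω'] {P : Measure Ω}
  [IsProbabilityMeasure P] {P' : Measure Ω'} {Z : Ω' → cube d → ℝ}
  {β₀ CZ : ℝ}

/-- The variable `M` comes with the generic field only, and its inequality holds almost surely for
each pair of points separately. The seminorm on a finite set is a measurable functional of the path,
so its moments pass to every `Zs i` by equality in law. Since distances in the cube are at most 1,
the exponent may be lowered to `β₀`. -/
lemma memLp_holderBound (hβ₀ : 0 < β₀) (hZ : InProcessClass P' β₀ CZ Z) (S : Finset (cube d)) :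
    MemLp (fun ω => holderBound S β₀ (Z ω)) 2 P' ∧
      ∫ ω, holderBound S β₀ (Z ω) ^ 2 ∂P' ≤ 2 * CZ := by
  obtain ⟨hmeas, β, hβ, M, -, hMpos, hM2, hZ2, hle, hH⟩ := hZ
  have hae : ∀ᵐ ω ∂P', holderBound S β₀ (Z ω) ≤ |Z ω (origin d)| + M ω := by
    have hall : ∀ᵐ ω ∂P', ∀ q : S × S, |Z ω q.1 - Z ω q.2| ≤
        M ω * ‖(q.1 : cube d).1 - (q.2 : cube d).1‖ ^ β := ae_all_iff.2 fun q => hH _ _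
    filter_upwards [hall, hMpos] with ω h1 h2
    refine add_le_add le_rfl (holderOn_le h2.le fun u hu v hv => (h1 (⟨u, hu⟩, ⟨v, hv⟩)).trans ?_)
    refine mul_le_mul_of_nonneg_left ?_ h2.le
    rcases eq_or_lt_of_le (norm_nonneg (u.1 - v.1)) with h0 | h0
    · rw [← h0, Real.zero_rpow (by linarith [hβ.1]), Real.zero_rpow hβ₀.ne']
    · exact Real.rpow_le_rpow_of_exponent_ge h0 (norm_sub_le_one u v) hβ.1
  have hsum : MemLp (fun ω => |Z ω (origin d)| + M ω) 2 P' := hZ2.abs.add hM2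
  have hLp : MemLp (fun ω => holderBound S β₀ (Z ω)) 2 P' := by
    refine hsum.mono ((measurable_holderBound S β₀).comp
      (measurable_pi_lambda _ hmeas)).aestronglyMeasurable ?_
    filter_upwards [hae] with ω h
    rw [Real.norm_of_nonneg (holderBound_nonneg _ _ _)]
    exact h.trans (le_abs_self _)
  refine ⟨hLp, ?_⟩
  calc ∫ ω, holderBound S β₀ (Z ω) ^ 2 ∂P'
      ≤ ∫ ω, (2 * M ω ^ 2 + 2 * Z ω (origin d) ^ 2) ∂P' := by
        refine integral_mono_ae hLp.integrable_sq
          ((hM2.integrable_sq.const_mul 2).add (hZ2.integrable_sq.const_mul 2)) ?_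
        filter_upwards [hae] with ω h
        have h0 := holderBound_nonneg S β₀ (Z ω)
        have h1 := sq_abs (Z ω (origin d))
        nlinarith [sq_nonneg (|Z ω (origin d)| - M ω)]
    _ = 2 * (∫ ω, M ω ^ 2 ∂P' + ∫ ω, Z ω (origin d) ^ 2 ∂P') := by
        rw [integral_add (hM2.integrable_sq.const_mul 2) (hZ2.integrable_sq.const_mul 2),
          integral_const_mul, integral_const_mul]
        ring
    _ ≤ 2 * CZ := by linarith

lemma exists_dyadic_level {β : ℝ} (hβ : 0 < β) (n : ℕ) :
    ∃ K : ℕ, ((2 : ℝ) ^ K)⁻¹ ^ β * Real.sqrt n ≤ 1 := by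
  have hr1 : (2 : ℝ)⁻¹ ^ β < 1 := Real.rpow_lt_one (by norm_num) (by norm_num) hβ
  obtain ⟨K, hK⟩ := exists_pow_lt_of_lt_one (y := (2 : ℝ)⁻¹ ^ β)
    (show (0 : ℝ) < (Real.sqrt n + 1)⁻¹ by positivity) hr1
  refine ⟨K, ?_⟩
  have h1 : ((2 : ℝ) ^ K)⁻¹ ^ β = ((2 : ℝ)⁻¹ ^ β) ^ K := by
    rw [← inv_pow, ← Real.rpow_natCast, ← Real.rpow_natCast, ← Real.rpow_mul (by norm_num),
      ← Real.rpow_mul (by norm_num), mul_comm]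
  rw [h1]
  calc _ ≤ (Real.sqrt n + 1)⁻¹ * (Real.sqrt n + 1) := by
        gcongr
        linarith
    _ = 1 := inv_mul_cancel₀ (by positivity)

/-- The maximal inequality for sums of independent centered Hölder processes. -/
theorem integral_norm_sum_process_le {n : ℕ} (hn : 0 < n) (hβ₀ : 0 < β₀) (hCZ : 0 < CZ)
    (hZ : InProcessClass P' β₀ CZ Z) {Zs : Fin n → Ω → cube d → ℝ}
    (hmeas : ∀ i x, Measurable fun ω => Zs i ω x) (hind : iIndepFun Zs P)
    (hid : ∀ i, IdentDistrib (Zs i) Z P P') (h0 : ∀ x, ∫ ω, Z ω x ∂P' = 0)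
    {J : Type*} [Fintype J] (pts : J → cube d) :
    Integrable (fun ω => ‖fun j => ∑ i, Zs i ω (pts j)‖) P ∧
    ∫ ω, ‖fun j => ∑ i, Zs i ω (pts j)‖ ∂P ≤
      2 * (((∑' k, chainTerm d β₀ k) + 1) * Real.sqrt (n * (2 * CZ))) := by
  obtain ⟨K, hK⟩ := exists_dyadic_level hβ₀ n
  set S := chainSet pts K with hS
  set C := (∑' k, chainTerm d β₀ k) + 1 with hC
  have hC0 : 0 ≤ C := add_nonneg (tsum_nonneg (chainTerm_nonneg d β₀)) zero_le_one
  set b : Fin n → Ω → ℝ := fun i ω => holderBound S β₀ (Zs i ω) with hb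
  have hbZ := memLp_holderBound hβ₀ hZ S
  have hidb : ∀ i, IdentDistrib (b i) (fun ω => holderBound S β₀ (Z ω)) P P' := fun i =>
    (hid i).comp (measurable_holderBound S β₀)
  have hbLp : ∀ i, MemLp (b i) 2 P := fun i => (hidb i).memLp_iff.2 hbZ.1
  have hbsq : ∀ i, ∫ ω, b i ω ^ 2 ∂P ≤ 2 * CZ := fun i => by
    have := ((hidb i).comp (measurable_id.pow_const 2)).integral_eq
    simp only [Function.comp_def, id] at this
    rw [this]
    exact hbZ.2
  set τ := Real.sqrt (n * (2 * CZ)) with hτ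
  have hn' : (0 : ℝ) < n := by exact_mod_cast hn
  have hτpos : 0 < τ := Real.sqrt_pos.2 (by positivity)
  have hτsq : τ ^ 2 = n * (2 * CZ) := Real.sq_sqrt (by positivity)
  set s : Ω → ℝ := fun ω => ∑ i, b i ω ^ 2 with hs
  have hsint : Integrable s P := integrable_finsetSum _ fun i _ => (hbLp i).integrable_sq
  have hs0 : ∀ ω, 0 ≤ s ω := fun ω => Finset.sum_nonneg fun i _ => sq_nonneg _
  have hsle : ∫ ω, s ω ∂P ≤ τ ^ 2 := by
    rw [hτsq, hs, integral_finsetSum _ fun i _ => (hbLp i).integrable_sq]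
    refine (Finset.sum_le_sum fun i _ => hbsq i).trans_eq ?_
    simp
  -- The arithmetic-geometric mean inequality gives both integrability of `√s` and, since `𝔼 s ≤
  -- τ²`, the bound `𝔼 √s ≤ τ`.
  have hsq : ∀ ω, Real.sqrt (s ω) ≤ (s ω / τ + τ) / 2 := by
    intro ω
    rw [le_div_iff₀ two_pos, div_add' _ _ _ hτpos.ne', le_div_iff₀ hτpos]
    nlinarith [sq_nonneg (Real.sqrt (s ω) - τ), Real.sq_sqrt (hs0 ω)]
  have hdom : Integrable (fun ω => (s ω / τ + τ) / 2) P :=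
    ((hsint.div_const τ).add (integrable_const τ)).div_const 2
  have hsqint : Integrable (fun ω => Real.sqrt (s ω)) P := by
    refine hdom.mono' hsint.aestronglyMeasurable.aemeasurable.sqrt.aestronglyMeasurable
      (Filter.Eventually.of_forall fun ω => ?_)
    rw [Real.norm_of_nonneg (Real.sqrt_nonneg _)]
    exact hsq ω
  have hsqle : ∫ ω, Real.sqrt (s ω) ∂P ≤ τ := by
    calc _ ≤ ∫ ω, (s ω / τ + τ) / 2 ∂P := integral_mono hsqint hdom hsq
      _ = ((∫ ω, s ω ∂P) / τ + τ) / 2 := by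
          rw [integral_div, integral_add (hsint.div_const τ) (integrable_const τ), integral_div]
          simp
      _ ≤ (τ ^ 2 / τ + τ) / 2 := by gcongr
      _ = τ := by field_simp; ring
  set X : Fin n → Ω → J → ℝ := fun i ω j => Zs i ω (pts j) with hX
  have hXm : ∀ i, Measurable (X i) := fun i => measurable_pi_lambda _ fun j => hmeas i _
  have hval : ∀ i j, Integrable (fun ω => Zs i ω (pts j)) P := fun i j =>
    ((hbLp i).integrable (by norm_num)).mono' (hmeas i _).aestronglyMeasurable
      (Filter.Eventually.of_forall fun ω =>
        abs_le_holderBound hβ₀.le _ origin_mem_chainSet (pts_mem_chainSet j))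
  have hXint : ∀ i, Integrable (X i) P := fun i => Integrable.of_eval (hval i)
  have hX0 : ∀ i, ∫ ω, X i ω ∂P = 0 := fun i => by
    funext j
    rw [eval_integral (hval i)]
    have := ((hid i).comp (measurable_pi_apply (pts j))).integral_eq
    simp only [Function.comp_def] at this
    rw [Pi.zero_apply, ← h0 (pts j), ← this]
  have hXind : iIndepFun X P := hind.comp (fun _ (z : cube d → ℝ) j => z (pts j))
    fun _ => measurable_pi_lambda _ fun j => measurable_pi_apply _
  have hsumX : ∀ ω, (fun j => ∑ i, Zs i ω (pts j)) = ∑ i, X i ω := fun ω => by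
    funext j; simp [hX]
  -- Chaining is applied for each fixed `ω`, with the random Hölder bounds `b i ω` as constants.
  have hmain := integral_norm_sum_le_sum_sgn hXind hXm hXint hX0 (B := fun ω => C * Real.sqrt (s ω))
    (hsqint.const_mul C) fun ω => by
      have h := sum_sgn_chaining_le (pts := pts) (K := K) hβ₀ (fun i => Zs i ω) (fun i => b i ω)
        (fun i => holderBound_nonneg _ _ _)
        (fun i u hu => abs_le_holderBound hβ₀.le _ origin_mem_chainSet hu)
        (fun i u hu v hv => (abs_sub_le_holderOn _ hu hv).trans (mul_le_mul_of_nonneg_right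
          (le_add_of_nonneg_left (abs_nonneg _)) (by positivity))) hK
      refine le_trans (le_of_eq (Finset.sum_congr rfl fun e _ => ?_)) h
      congr 1
      funext j
      simp [hX]
  simp_rw [hsumX]
  refine ⟨(integrable_finsetSum _ fun i _ => hXint i).norm, hmain.trans ?_⟩
  rw [integral_const_mul]
  gcongr

end Fields

/-! ### The averaged errors -/

section Noise

variable {d n : ℕ} {p : Fin d → ℕ} {Ω Ω' : Type*} [MeasurableSpace Ω] [MeasurableSpace Ω']
  {P : Measure Ω} {P' : Measure Ω'} {Z : Ω' → cube d → ℝ} {ζ σ : ℝ}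
  {Zs : Fin n → Ω → cube d → ℝ} {ε : Fin n → Idx p → Ω → ℝ}

lemma rpow_neg_half_eq (n : ℕ) : (n : ℝ) ^ (-(1 / 2) : ℝ) = (Real.sqrt n)⁻¹ := by
  rw [Real.rpow_neg (Nat.cast_nonneg n), Real.sqrt_eq_rpow]

/-- Variance proxies of independent summands add up: each of the `n` errors at `j` contributes at
most `(a j / n)² ζ² σ²`. -/
lemma hasSubgaussianMGF_sum_error (hM : ModelAssumptions P P' ζ σ Z Zs ε) (hn : 0 < n)
    (a : Idx p → ℝ) :
    HasSubgaussianMGF (fun ω => ∑ j, a j * (1 / (n : ℝ) * ∑ i, ε i j ω))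
      (ζ ^ 2 * σ ^ 2 / n * ∑ j, a j ^ 2).toNNReal P := by
  have hn' : (0 : ℝ) < n := by exact_mod_cast hn
  have hind : iIndepFun (fun (ij : Fin n × Idx p) ω => a ij.2 / n * ε ij.1 ij.2 ω) P :=
    hM.indep_error.comp (fun ij x => a ij.2 / n * x) fun ij => measurable_const_mul _
  have hsub : ∀ ij ∈ (Finset.univ : Finset (Fin n × Idx p)),
      HasSubgaussianMGF (fun ω => a ij.2 / n * ε ij.1 ij.2 ω)
        ((a ij.2 / n) ^ 2 * (ζ ^ 2 * σ ^ 2)).toNNReal P := fun ij _ => by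
    refine hasSubgaussianMGF_mono ((hM.subgaussian_error ij.1 ij.2).const_mul (a ij.2 / n)) ?_
    rw [← NNReal.coe_le_coe, Real.coe_toNNReal (_ * (_ * _)) (by positivity)]
    change (a ij.2 / n) ^ 2 * ((ζ ^ 2 * ∫ ω, ε ij.1 ij.2 ω ^ 2 ∂P).toNNReal : ℝ) ≤ _
    refine mul_le_mul_of_nonneg_left ?_ (sq_nonneg _)
    rw [Real.coe_toNNReal _ (mul_nonneg (sq_nonneg _) (integral_nonneg fun _ => sq_nonneg _))]
    exact mul_le_mul_of_nonneg_left (hM.variance_error _ _) (sq_nonneg _)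
  have h := HasSubgaussianMGF.sum_of_iIndepFun hind hsub
  have hfun : (fun ω => ∑ ij : Fin n × Idx p, a ij.2 / n * ε ij.1 ij.2 ω) =
      fun ω => ∑ j, a j * (1 / (n : ℝ) * ∑ i, ε i j ω) := by
    funext ω
    rw [Fintype.sum_prod_type_right]
    refine Finset.sum_congr rfl fun j _ => ?_
    rw [Finset.mul_sum, Finset.mul_sum]
    exact Finset.sum_congr rfl fun i _ => by ring
  rw [hfun] at h
  refine hasSubgaussianMGF_mono h (le_of_eq ?_)
  rw [← Real.toNNReal_sum_of_nonneg fun ij _ => by positivity, Fintype.sum_prod_type_right]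
  congr 1
  simp only [Finset.sum_const, Finset.card_univ, Fintype.card_fin, nsmul_eq_mul]
  rw [Finset.mul_sum]
  refine Finset.sum_congr rfl fun j _ => ?_
  field_simp

lemma integrable_avg_error (hM : ModelAssumptions P P' ζ σ Z Zs ε) (j : Idx p) :
    Integrable (fun ω => 1 / (n : ℝ) * ∑ i, ε i j ω) P :=
  (integrable_finsetSum _ fun i _ => (hM.subgaussian_error i j).integrable).const_mul _

/-- The maximal inequality over a one-point index set, with `a` a unit vector. -/
lemma integral_abs_avg_error_le [IsProbabilityMeasure P]
    (hM : ModelAssumptions P P' ζ σ Z Zs ε) (hn : 0 < n)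
    (hζ : 0 < ζ) (hσ : 0 ≤ σ) (j : Idx p) :
    ∫ ω, |1 / (n : ℝ) * ∑ i, ε i j ω| ∂P ≤
      ζ * σ * Real.sqrt (2 * Real.log 2) * (n : ℝ) ^ (-(1 / 2) : ℝ) := by
  classical
  have h1 := hasSubgaussianMGF_sum_error hM hn (Pi.single j 1)
  have h2 : ∑ k, (Pi.single j (1 : ℝ) : Idx p → ℝ) k ^ 2 = 1 := by
    simp [Pi.single_apply]
  have h3 : (fun ω => ∑ k, (Pi.single j (1 : ℝ) : Idx p → ℝ) k * (1 / (n : ℝ) * ∑ i, ε i k ω)) =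
      fun ω => 1 / (n : ℝ) * ∑ i, ε i j ω := by
    funext ω
    simp [Pi.single_apply]
  have h4 : ζ ^ 2 * σ ^ 2 / n = (ζ * σ * (Real.sqrt n)⁻¹) ^ 2 := by
    rw [mul_pow, mul_pow, inv_pow, Real.sq_sqrt (Nat.cast_nonneg n)]
    ring
  rw [h2, h3, mul_one, h4] at h1
  have h5 := integral_pi_norm_le (ι := Unit) (N := 1)
    (X := fun _ ω => 1 / (n : ℝ) * ∑ i, ε i j ω) (by positivity) (by simp) fun _ => h1
  simp only [pi_norm_const, Real.norm_eq_abs, mul_one] at h5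
  rw [rpow_neg_half_eq]
  linarith

variable {D : ProductDesign p} {C₁ C₂ C₃ h : ℝ} {γ : ℕ} {w : Idx p → cube d → ℝ}

/-- The ratio of the logarithmic size of the net to `log (1 / h)`. -/
noncomputable def netConst (d : ℕ) : ℝ := Real.log (2 * 3 ^ d) / Real.log 2 + d * (d + 1)

/-- The constant in the bound for the averaged errors. -/
noncomputable def noiseConst (d : ℕ) (ζ σ C₁ C₂ C₃ : ℝ) : ℝ :=
  Real.sqrt (2 * netConst d * (ζ ^ 2 * σ ^ 2 * (C₁ ^ 2 * C₃))) +
    (C₂ + C₁ * 2 ^ d) * (ζ * σ * Real.sqrt (2 * Real.log 2))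

/-- The argument of the logarithm bounds twice the size of a grid of mesh about `h^(d+1)`. For `h ≤
1/2` one has `log (1/h) ≥ log 2`, which absorbs the constant factors. -/
lemma log_two_mul_net_le (hh : 0 < h) (hh2 : h ≤ 1 / 2) :
    Real.log (2 * (3 * (h ^ (d + 1))⁻¹) ^ d) ≤ netConst d * Real.log h⁻¹ := by
  have h1 : 2 * (3 * (h ^ (d + 1))⁻¹) ^ d = 2 * 3 ^ d * h⁻¹ ^ (d * (d + 1)) := by
    rw [mul_pow, ← inv_pow, ← pow_mul, mul_comm (d + 1) d, mul_assoc]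
  have h2 : Real.log 2 ≤ Real.log h⁻¹ :=
    Real.log_le_log two_pos (by rw [le_inv_comm₀ two_pos hh]; linarith)
  have hlog2 : 0 < Real.log 2 := Real.log_pos one_lt_two
  have h3 : 0 ≤ Real.log (2 * 3 ^ d) := Real.log_nonneg <| by
    have : (1 : ℝ) ≤ 3 ^ d := one_le_pow₀ (by norm_num)
    linarith
  rw [h1, Real.log_mul (by positivity) (by positivity), Real.log_pow, netConst, add_mul]
  push_cast
  have h4 : Real.log (2 * 3 ^ d) ≤ Real.log (2 * 3 ^ d) / Real.log 2 * Real.log h⁻¹ := by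
    rw [div_mul_eq_mul_div, le_div_iff₀ hlog2]
    gcongr
  linarith

/-- The maximal inequality for the weighted averages of the errors. -/
theorem exists_noise_bound [IsProbabilityMeasure P]
    (hM : ModelAssumptions P P' ζ σ Z Zs ε) (hn : 0 < n)
    (hζ : 0 < ζ) (hσ : 0 ≤ σ) (hw : WeightConditions D γ C₁ C₂ h w)
    (hcard : ∀ x : cube d, (Nat.card {j : Idx p //
      ∀ k, x.1 k - h ≤ (D.pt j).1 k ∧ (D.pt j).1 k ≤ x.1 k + h} : ℝ) ≤ C₃ * h ^ d * pProd p)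
    (hh : 0 < h) (hC₁ : 0 < C₁) (hC₂ : 0 < C₂) (hC₃ : 0 < C₃) (hp : 0 < pProd p) :
    ∃ G : Ω → ℝ, Integrable G P ∧
      (∀ ω x, |∑ j, w j x * (1 / (n : ℝ) * ∑ i, ε i j ω)| ≤ G ω) ∧
      ∫ ω, G ω ∂P ≤ noiseConst d ζ σ C₁ C₂ C₃ *
        max (Real.sqrt (Real.log h⁻¹ / (n * pProd p * h ^ d))) ((n : ℝ) ^ (-(1 / 2) : ℝ)) := by
  have hp' : (0 : ℝ) < pProd p := by exact_mod_cast hp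
  have hn' : (0 : ℝ) < n := by exact_mod_cast hn
  set e : Idx p → Ω → ℝ := fun j ω => 1 / (n : ℝ) * ∑ i, ε i j ω with he
  have heint : ∀ j, Integrable (e j) P := integrable_avg_error hM
  -- The average over the design of the absolute averaged errors; its mean is of order `n^{-1/2}`,
  -- and it controls all remainders below.
  set A : Ω → ℝ := fun ω => (∑ j, |e j ω|) / pProd p with hA
  have hAint : Integrable A P :=
    (integrable_finsetSum _ fun j _ => (heint j).abs).div_const _
  set κ := ζ * σ * Real.sqrt (2 * Real.log 2) with hκ
  have hκ0 : 0 ≤ κ := by positivity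
  set rn := (n : ℝ) ^ (-(1 / 2) : ℝ) with hrn
  have hrn0 : 0 ≤ rn := by positivity
  set rs := Real.sqrt (Real.log h⁻¹ / (n * pProd p * h ^ d)) with hrs
  set a₁ := Real.sqrt (2 * netConst d * (ζ ^ 2 * σ ^ 2 * (C₁ ^ 2 * C₃))) with ha₁
  have ha₁0 : 0 ≤ a₁ := Real.sqrt_nonneg _
  have hAle : ∫ ω, A ω ∂P ≤ κ * rn := by
    rw [hA, integral_div, integral_finsetSum _ fun j _ => (heint j).abs, div_le_iff₀ hp']
    refine (Finset.sum_le_sum fun j _ => integral_abs_avg_error_le hM hn hζ hσ j).trans_eq ?_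
    have : (Fintype.card (Idx p) : ℝ) = pProd p := by simp [pProd]
    rw [Finset.sum_const, Finset.card_univ, nsmul_eq_mul, this]
    ring
  by_cases hh2 : h ≤ 1 / 2
  -- With mesh at most `h^(d+1)`, the Lipschitz bound on a weight becomes `C₂ / (p^𝟏 h^d) * h^d = C₂
  -- / p^𝟏`, so the discretization error is at most `C₂ * A`.
  · set x₀ : ℝ := (h ^ (d + 1))⁻¹ with hx₀
    have hx₀1 : 1 ≤ x₀ :=
      (one_le_inv₀ (by positivity)).2 (pow_le_one₀ hh.le (by linarith))
    set m := ⌈x₀⌉₊ with hm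
    have hmpos : 0 < m := Nat.ceil_pos.2 (by linarith)
    have hmx : x₀ ≤ m := Nat.le_ceil x₀
    have hmle : (m : ℝ) + 1 ≤ 3 * x₀ := by
      have := Nat.ceil_lt_add_one (show 0 ≤ x₀ by linarith)
      linarith
    have hmesh : 1 / (m : ℝ) ≤ h ^ (d + 1) := by
      rw [one_div, inv_le_comm₀ (by exact_mod_cast hmpos) (by positivity)]
      exact hmx
    set V : (Fin d → Fin (m + 1)) → Ω → ℝ := fun q ω => ∑ j, w j (gridPt m q) * e j ω with hV
    have hVint : ∀ q, Integrable (V q) P := fun q =>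
      integrable_finsetSum _ fun j _ => (heint j).const_mul _
    have hNint := integrable_pi_norm hVint
    refine ⟨fun ω => ‖fun q => V q ω‖ + C₂ * A ω, hNint.add (hAint.const_mul C₂), ?_, ?_⟩
    · intro ω x
      set g := gridPt m (gridIdx m x) with hg
      have h1 : ∑ j, w j x * e j ω = ∑ j, w j g * e j ω + ∑ j, (w j x - w j g) * e j ω := by
        rw [← Finset.sum_add_distrib]
        exact Finset.sum_congr rfl fun j _ => by ring
      change |∑ j, w j x * e j ω| ≤ _
      rw [h1]
      refine (abs_add_le _ _).trans (add_le_add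
        (norm_le_pi_norm (fun q => V q ω) (gridIdx m x)) ?_)
      refine (Finset.abs_sum_le_sum_abs _ _).trans ?_
      rw [hA, mul_div_assoc', Finset.mul_sum, Finset.sum_div]
      refine Finset.sum_le_sum fun j _ => ?_
      rw [abs_mul, mul_div_right_comm]
      refine mul_le_mul_of_nonneg_right ?_ (abs_nonneg _)
      calc |w j x - w j g| ≤ C₂ / (pProd p * h ^ d) * min (‖x.1 - g.1‖ / h) 1 := hw.lipschitz j x g
        _ ≤ C₂ / (pProd p * h ^ d) * (h ^ (d + 1) / h) := by
            have := (norm_sub_gridPt_le hmpos x).trans hmesh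
            refine mul_le_mul_of_nonneg_left ((min_le_left _ _).trans ?_) (by positivity)
            gcongr
        _ = C₂ / pProd p := by rw [pow_succ]; field_simp
    · have hlog := log_two_mul_net_le (d := d) hh hh2
      have hnet : (0 : ℝ) < n * pProd p * h ^ d := by positivity
      have hVle : ∫ ω, ‖fun q => V q ω‖ ∂P ≤ a₁ * rs := by
        set s := Real.sqrt (ζ ^ 2 * σ ^ 2 / n * (C₁ ^ 2 * C₃ / (pProd p * h ^ d))) with hs
        have hs2 : s ^ 2 = ζ ^ 2 * σ ^ 2 / n * (C₁ ^ 2 * C₃ / (pProd p * h ^ d)) :=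
          Real.sq_sqrt (by positivity)
        refine (integral_pi_norm_le (s := s) (N := (3 * x₀) ^ d) (Real.sqrt_nonneg _) ?_
          fun q => ?_).trans ?_
        · simp only [Fintype.card_pi, Fintype.card_fin, Finset.prod_const, Finset.card_univ]
          push_cast
          gcongr
        · refine hasSubgaussianMGF_mono (hasSubgaussianMGF_sum_error hM hn
            fun j => w j (gridPt m q)) (Real.toNNReal_le_toNNReal ?_)
          rw [hs2]
          exact mul_le_mul_of_nonneg_left (sum_sq_weight_le hw hcard hh hC₁ hp _) (by positivity)
        · calc s * Real.sqrt (2 * Real.log (2 * (3 * x₀) ^ d))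
              ≤ s * Real.sqrt (2 * (netConst d * Real.log h⁻¹)) := by gcongr
            _ = a₁ * rs := by
                have hnc : 0 ≤ netConst d := by
                  have : (1 : ℝ) ≤ 3 ^ d := one_le_pow₀ (by norm_num)
                  have : 0 ≤ Real.log (2 * 3 ^ d) := Real.log_nonneg (by linarith)
                  have := Real.log_pos one_lt_two
                  unfold netConst
                  positivity
                rw [hs, ha₁, hrs, ← Real.sqrt_mul (by positivity), ← Real.sqrt_mul (by positivity)]
                congr 1
                field_simp
      rw [integral_add hNint (hAint.const_mul C₂), integral_const_mul]
      calc _ ≤ a₁ * rs + C₂ * (κ * rn) := by gcongr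
        _ ≤ a₁ * max rs rn + (C₂ + C₁ * 2 ^ d) * κ * max rs rn := by
            have h1 := le_max_left rs rn
            have h2 := le_max_right rs rn
            have h3 : C₂ * (κ * rn) ≤ (C₂ + C₁ * 2 ^ d) * κ * max rs rn := by
              rw [← mul_assoc]
              have : 0 ≤ C₁ * 2 ^ d := by positivity
              gcongr
              linarith
            gcongr
        _ = _ := by rw [noiseConst]; ring
  -- For large `h` no grid is needed: every weight is at most `C₁ 2^d / p^𝟏`, so the parametric rate
  -- holds even where `log (1/h)` is small or negative.
  · have hh3 : 1 / 2 < h := not_le.1 hh2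
    refine ⟨fun ω => C₁ * 2 ^ d * A ω, hAint.const_mul _, ?_, ?_⟩
    · intro ω x
      change |∑ j, w j x * e j ω| ≤ _
      refine (Finset.abs_sum_le_sum_abs _ _).trans ?_
      simp only [hA]
      rw [mul_div_assoc', Finset.mul_sum, Finset.sum_div]
      refine Finset.sum_le_sum fun j _ => ?_
      rw [abs_mul, mul_div_right_comm]
      refine mul_le_mul_of_nonneg_right ((hw.abs_le j x).trans ?_) (abs_nonneg _)
      rw [div_le_div_iff₀ (by positivity) hp']
      have h1 : 1 ≤ 2 ^ d * h ^ d := by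
        rw [← mul_pow]
        exact one_le_pow₀ (by linarith)
      nlinarith [mul_pos hC₁ hp']
    · rw [integral_const_mul]
      calc _ ≤ C₁ * 2 ^ d * (κ * rn) := by gcongr
        _ ≤ (C₂ + C₁ * 2 ^ d) * κ * max rs rn := by
            rw [← mul_assoc]
            have h2 := le_max_right rs rn
            gcongr
            linarith
        _ ≤ _ := by
            rw [noiseConst]
            refine mul_le_mul_of_nonneg_right ?_ (hrn0.trans (le_max_right _ _))
            exact le_add_of_nonneg_left ha₁0

end Noise

/-! ### The bound for a single bandwidth -/

section Rate

variable {d n : ℕ} {p : Fin d → ℕ}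

/-- The constant in the bound for a single bandwidth. -/
noncomputable def errorConst (d : ℕ) (α L β₀ CZ ζ σ C₁ C₂ C₃ : ℝ) : ℝ :=
  C₁ * C₃ * (d ^ strictFloor α * L) +
    C₁ * C₃ * (2 * (((∑' k, chainTerm d β₀ k) + 1) * Real.sqrt (2 * CZ))) +
    noiseConst d ζ σ C₁ C₂ C₃

lemma noiseConst_nonneg (d : ℕ) {ζ σ C₁ C₂ : ℝ} (C₃ : ℝ) (hζ : 0 < ζ) (hσ : 0 ≤ σ) (hC₁ : 0 < C₁)
    (hC₂ : 0 < C₂) : 0 ≤ noiseConst d ζ σ C₁ C₂ C₃ := by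
  unfold noiseConst; positivity

lemma errorConst_nonneg (d : ℕ) {α L β₀ CZ ζ σ C₁ C₂ C₃ : ℝ} (hL : 0 < L) (hζ : 0 < ζ)
    (hσ : 0 ≤ σ) (hC₁ : 0 < C₁) (hC₂ : 0 < C₂) (hC₃ : 0 < C₃) :
    0 ≤ errorConst d α L β₀ CZ ζ σ C₁ C₂ C₃ := by
  have h1 := noiseConst_nonneg d C₃ hζ hσ hC₁ hC₂
  have h2 : 0 ≤ ∑' k, chainTerm d β₀ k := tsum_nonneg (chainTerm_nonneg d β₀)
  unfold errorConst
  positivity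

/-- The error is dominated pointwise by an integrable `R` free of `x`, so measurability of the
supremum is never needed. The counting bound enters only at this one `h`, which lets the second part
of the theorem use a larger constant in place of `C₃`. -/
theorem expectedSupError_le {Ω Ω' : Type*} [MeasurableSpace Ω] [MeasurableSpace Ω']
    {P : Measure Ω} [IsProbabilityMeasure P] {P' : Measure Ω'}
    {Z : Ω' → cube d → ℝ} {Zs : Fin n → Ω → cube d → ℝ} {ε : Fin n → Idx p → Ω → ℝ}
    {D : ProductDesign p} {w : Idx p → cube d → ℝ} {α L β₀ CZ ζ σ C₁ C₂ C₃ h : ℝ}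
    (hα : 0 < α) (hL : 0 < L) (hβ₀ : 0 < β₀) (hCZ : 0 < CZ) (hζ : 0 < ζ) (hσ : 0 ≤ σ)
    (hC₁ : 0 < C₁) (hC₂ : 0 < C₂) (hC₃ : 0 < C₃) (hn : 0 < n) (hp : 0 < pProd p) (hh : 0 < h)
    (hcard : ∀ x : cube d, (Nat.card {j : Idx p //
      ∀ k, x.1 k - h ≤ (D.pt j).1 k ∧ (D.pt j).1 k ≤ x.1 k + h} : ℝ) ≤ C₃ * h ^ d * pProd p)
    (hw : WeightConditions D (strictFloor α) C₁ C₂ h w)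
    (hZ : InProcessClass P' β₀ CZ Z) (hM : ModelAssumptions P P' ζ σ Z Zs ε)
    {μ : (Fin d → ℝ) → ℝ} (hμ : μ ∈ HolderClass (d := d) α L) :
    expectedSupError P D w μ Zs ε ≤
      ENNReal.ofReal (errorConst d α L β₀ CZ ζ σ C₁ C₂ C₃ * rate α n p h) := by
  have hn' : (0 : ℝ) < n := by exact_mod_cast hn
  obtain ⟨G, hGint, hGle, hG⟩ := exists_noise_bound hM hn hζ hσ hw hcard hh hC₁ hC₂ hC₃ hp
  set Cb := C₁ * C₃ * (d ^ strictFloor α * L) with hCb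
  set Cc := 2 * (((∑' k, chainTerm d β₀ k) + 1) * Real.sqrt (2 * CZ)) with hCc
  have hCc0 : 0 ≤ Cc := by
    have h2 : 0 ≤ ∑' k, chainTerm d β₀ k := tsum_nonneg (chainTerm_nonneg d β₀)
    positivity
  set V : Ω → ℝ := fun ω => ‖fun j => ∑ i, Zs i ω (D.pt j)‖ with hV
  obtain ⟨hVint', hVle⟩ := integral_norm_sum_process_le hn hβ₀ hCZ hZ hM.measurable_field
    hM.indep_field hM.identDistrib_field hM.centered_field D.pt
  have hVint : Integrable V P := hVint'
  set rn := (n : ℝ) ^ (-(1 / 2) : ℝ) with hrn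
  have hVle' : ∫ ω, V ω / n ∂P ≤ Cc * rn := by
    rw [integral_div, div_le_iff₀ hn', hrn, rpow_neg_half_eq]
    refine hVle.trans_eq ?_
    have h1 : (Real.sqrt n)⁻¹ * n = Real.sqrt n := by
      have h2 := Real.mul_self_sqrt hn'.le
      have h3 := Real.sqrt_pos.2 hn'
      nth_rewrite 2 [← h2]
      field_simp
    rw [mul_assoc, h1, Real.sqrt_mul hn'.le]
    ring
  set R : Ω → ℝ := fun ω => Cb * h ^ α + (C₁ * C₃ * (V ω / n) + G ω) with hR
  have hR2 : Integrable (fun ω => C₁ * C₃ * (V ω / n) + G ω) P :=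
    ((hVint.div_const _).const_mul _).add hGint
  have hRint : Integrable R P := (integrable_const _).add hR2
  have hpt : ∀ ω (x : cube d), |linearEstimator w (response D μ Zs ε) x ω - μ x| ≤ R ω := by
    intro ω x
    have hdec : linearEstimator w (response D μ Zs ε) x ω - μ x =
        (∑ j, w j x * μ (D.pt j) - μ x) + (∑ j, w j x * ((∑ i, Zs i ω (D.pt j)) / n) +
          ∑ j, w j x * (1 / (n : ℝ) * ∑ i, ε i j ω)) := by
      rw [← Finset.sum_add_distrib, sub_add_eq_add_sub, ← Finset.sum_add_distrib,
        linearEstimator]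
      congr 1
      refine Finset.sum_congr rfl fun j _ => ?_
      simp only [response, Finset.sum_add_distrib, Finset.sum_const, Finset.card_univ,
        Fintype.card_fin, nsmul_eq_mul]
      field_simp
      ring
    rw [hdec]
    refine (abs_add_le _ _).trans (add_le_add (abs_bias_le hα hL hμ hw hcard hh hC₁ hp x)
      ((abs_add_le _ _).trans (add_le_add ?_ (hGle ω x))))
    calc |∑ j, w j x * ((∑ i, Zs i ω (D.pt j)) / n)|
        ≤ ∑ j, |w j x| * (V ω / n) := by
          refine (Finset.abs_sum_le_sum_abs _ _).trans (Finset.sum_le_sum fun j _ => ?_)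
          rw [abs_mul, abs_div, abs_of_pos hn']
          have := norm_le_pi_norm (fun j => ∑ i, Zs i ω (D.pt j)) j
          rw [Real.norm_eq_abs] at this
          gcongr
      _ = (∑ j, |w j x|) * (V ω / n) := by rw [Finset.sum_mul]
      _ ≤ C₁ * C₃ * (V ω / n) :=
          mul_le_mul_of_nonneg_right (sum_abs_weight_le hw hcard hh hC₁ hp x)
            (div_nonneg (norm_nonneg _) hn'.le)
  have hR0 : ∀ ω, 0 ≤ R ω := fun ω => (abs_nonneg _).trans (hpt ω (origin d))
  calc expectedSupError P D w μ Zs ε ≤ ∫⁻ ω, ENNReal.ofReal (R ω) ∂P := by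
        refine lintegral_mono fun ω => iSup_le fun x => ?_
        rw [← ofReal_norm]
        exact ENNReal.ofReal_le_ofReal (hpt ω x)
    _ = ENNReal.ofReal (∫ ω, R ω ∂P) :=
        (ofReal_integral_eq_lintegral_ofReal hRint (Filter.Eventually.of_forall hR0)).symm
    _ ≤ _ := by
        refine ENNReal.ofReal_le_ofReal ?_
        have hRi : ∫ ω, R ω ∂P = Cb * h ^ α + (C₁ * C₃ * ∫ ω, V ω / n ∂P + ∫ ω, G ω ∂P) := by
          rw [hR, integral_add (integrable_const _) hR2,
            integral_add ((hVint.div_const _).const_mul _) hGint,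
            integral_const_mul (C₁ * C₃) fun ω => V ω / n]
          simp
        have h1 : h ^ α ≤ rate α n p h := le_max_left _ _
        have h2 : max (Real.sqrt (Real.log h⁻¹ / (n * pProd p * h ^ d))) rn ≤ rate α n p h :=
          le_max_right _ _
        have h3 : rn ≤ rate α n p h := (le_max_right _ _).trans h2
        have h4 := noiseConst_nonneg d C₃ hζ hσ hC₁ hC₂
        have hCb0 : 0 ≤ Cb := by positivity
        rw [hRi]
        calc _ ≤ Cb * rate α n p h + (C₁ * C₃ * (Cc * rate α n p h) +
              noiseConst d ζ σ C₁ C₂ C₃ * rate α n p h) := by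
              refine add_le_add (by gcongr) (add_le_add ?_ (hG.trans (by gcongr)))
              exact mul_le_mul_of_nonneg_left (hVle'.trans (by gcongr)) (by positivity)
          _ = _ := by rw [errorConst]; ring

/-! ### The optimal bandwidth -/

lemma pMin_le (p : Fin d → ℕ) (k : Fin d) : pMin p ≤ p k := ciInf_le (OrderBot.bddBelow _) k

lemma pProd_pos (hp : 0 < pMin p) : 0 < pProd p :=
  Finset.prod_pos fun k _ => lt_of_lt_of_le hp (pMin_le p k)

/-- Needed because the design condition excludes `h = c / p_min`: boxes at that bandwidth are
counted through larger ones. -/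
lemma card_box_mono (D : ProductDesign p) (x : cube d) {h h' : ℝ} (hh : h ≤ h') :
    Nat.card {j : Idx p // ∀ k, x.1 k - h ≤ (D.pt j).1 k ∧ (D.pt j).1 k ≤ x.1 k + h} ≤
      Nat.card {j : Idx p // ∀ k, x.1 k - h' ≤ (D.pt j).1 k ∧ (D.pt j).1 k ≤ x.1 k + h'} := by
  refine Nat.card_le_card_of_injective
    (Subtype.map id fun j hj k => ⟨(by linarith : x.1 k - h' ≤ x.1 k - h).trans (hj k).1,
      (hj k).2.trans (by linarith)⟩)
    (Subtype.map_injective _ Function.injective_id)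

/-- For the bandwidth `hStar` all terms of `rate` are bounded by the optimal rate. -/
lemma rate_hStar_le {α c : ℝ} (hα : 0 < α) (hc : 0 < c) (hp : 0 < pMin p)
    (hlog : 1 ≤ Real.log (n * pProd p)) (hm : 0 < (n : ℝ) * pProd p) :
    rate α n p (hStar α c n p) ≤ (c ^ α + 1 + Real.sqrt (1 / (2 * α + d))) * optimalRate α n p := by
  have hp' : (0 : ℝ) < pMin p := by exact_mod_cast hp
  set m : ℝ := n * pProd p with hmdef
  set v := Real.log m / m with hv
  have hvpos : 0 < v := by positivity
  have hden : 0 < 2 * α + d := by positivity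
  set b := v ^ (1 / (2 * α + d)) with hb
  have hbpos : 0 < b := by positivity
  have hbα : b ^ α = v ^ (α / (2 * α + d)) := by
    rw [hb, ← Real.rpow_mul hvpos.le]; congr 1; ring
  set H := hStar α c n p with hH
  have hHdef : H = max (c / pMin p) b := rfl
  have hbH : b ≤ H := le_max_right _ _
  have hHpos : 0 < H := hbpos.trans_le hbH
  set o := optimalRate α n p with ho
  have ho1 : (pMin p : ℝ) ^ (-α) ≤ o := le_max_left _ _
  have ho2 : b ^ α ≤ o := by rw [hbα]; exact (le_max_left _ _).trans (le_max_right _ _)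
  have ho3 : (n : ℝ) ^ (-(1 / 2) : ℝ) ≤ o := (le_max_right _ _).trans (le_max_right _ _)
  have ho0 : 0 ≤ o := le_trans (by positivity) ho1
  set q := Real.sqrt (1 / (2 * α + d)) with hq
  have hq0 : 0 ≤ q := Real.sqrt_nonneg _
  have hcα : 0 ≤ c ^ α := by positivity
  refine max_le ?_ (max_le ?_ ?_)
  · have h1 : H ^ α ≤ (c ^ α + 1) * o := by
      rcases max_choice (c / (pMin p : ℝ)) b with h | h
      · rw [hHdef, h, Real.div_rpow hc.le hp'.le, div_eq_mul_inv, ← Real.rpow_neg hp'.le]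
        nlinarith
      · rw [hHdef, h]
        nlinarith
    nlinarith
  -- Here `log b⁻¹ = (log m - log log m) / (2α + d)`, and `log m ≥ 1` allows `log log m` to be
  -- dropped.
  · have hlogH : Real.log H⁻¹ ≤ Real.log m / (2 * α + d) := by
      calc Real.log H⁻¹ ≤ Real.log b⁻¹ :=
            Real.log_le_log (by positivity) (inv_anti₀ hbpos hbH)
        _ = (Real.log m - Real.log (Real.log m)) / (2 * α + d) := by
            rw [Real.log_inv, hb, Real.log_rpow hvpos, hv,
              Real.log_div (by positivity) hm.ne']
            ring
        _ ≤ _ := by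
            have := Real.log_nonneg hlog
            gcongr
            linarith
    -- The balance: `b^(2α+d) = v` gives `v / b^d = b^(2α)`.
    have hquot : Real.log H⁻¹ / (m * H ^ d) ≤ 1 / (2 * α + d) * (b ^ α) ^ 2 := by
      calc Real.log H⁻¹ / (m * H ^ d) ≤ (Real.log m / (2 * α + d)) / (m * b ^ d) := by
            refine div_le_div₀ (by positivity) hlogH (by positivity) ?_
            gcongr
        _ = 1 / (2 * α + d) * (v / b ^ d) := by rw [hv]; field_simp
        _ = 1 / (2 * α + d) * (b ^ α) ^ 2 := by
            congr 1
            rw [div_eq_iff (by positivity), ← Real.rpow_natCast (b ^ α) 2, ← Real.rpow_mul hbpos.le,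
              ← Real.rpow_natCast b d, ← Real.rpow_add hbpos, hb, ← Real.rpow_mul hvpos.le]
            have : 1 / (2 * α + (d : ℝ)) * (α * (2 : ℕ) + d) = 1 := by
              push_cast
              field_simp
            rw [this, Real.rpow_one]
    calc Real.sqrt (Real.log H⁻¹ / (m * H ^ d))
        ≤ Real.sqrt (1 / (2 * α + d) * (b ^ α) ^ 2) := Real.sqrt_le_sqrt hquot
      _ = q * b ^ α := by
          rw [Real.sqrt_mul (by positivity), Real.sqrt_sq (by positivity)]
      _ ≤ q * o := by gcongr
      _ ≤ _ := by nlinarith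
  · nlinarith

/-- The bandwidth `hStar` tends to zero uniformly. -/
lemma exists_hStar_le {α c η : ℝ} (d : ℕ) (hα : 0 < α) (hη : 0 < η) :
    ∃ N : ℕ, 1 ≤ N ∧ ∀ (n : ℕ) (p : Fin d → ℕ), N ≤ n → N ≤ pMin p →
      hStar α c n p ≤ η ∧ 1 ≤ Real.log (n * pProd p) := by
  have hden : 0 < 2 * α + d := by positivity
  have hev : ∀ᶠ x : ℝ in Filter.atTop, Real.log x / x ≤ η ^ (2 * α + d) ∧ 1 ≤ Real.log x := by
    have h1 : Filter.Tendsto (fun x : ℝ => Real.log x / x) Filter.atTop (nhds 0) := by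
      simpa using Real.tendsto_pow_log_div_mul_add_atTop 1 0 1 one_ne_zero
    exact (h1.eventually_le_const (by positivity)).and
      (Real.tendsto_log_atTop.eventually_ge_atTop 1)
  obtain ⟨x₀, hx₀⟩ := Filter.eventually_atTop.1 hev
  refine ⟨max 1 (max ⌈x₀⌉₊ ⌈c / η⌉₊), le_max_left _ _, fun n p hn hp => ?_⟩
  have hp1 : 0 < pMin p := lt_of_lt_of_le one_pos ((le_max_left _ _).trans hp)
  have hp' : (0 : ℝ) < pMin p := by exact_mod_cast hp1
  have hpP : (1 : ℝ) ≤ pProd p := by exact_mod_cast pProd_pos hp1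
  have hn1 : (1 : ℝ) ≤ n := by exact_mod_cast (le_max_left _ _).trans hn
  have hnx : x₀ ≤ n :=
    (Nat.le_ceil x₀).trans (by exact_mod_cast ((le_max_left _ _).trans (le_max_right _ _)).trans hn)
  have hpc : c / η ≤ pMin p :=
    (Nat.le_ceil _).trans (by exact_mod_cast ((le_max_right _ _).trans (le_max_right _ _)).trans hp)
  have hm : x₀ ≤ (n : ℝ) * pProd p := hnx.trans (by nlinarith)
  obtain ⟨h1, h2⟩ := hx₀ _ hm
  refine ⟨max_le ?_ ?_, h2⟩
  · rw [div_le_iff₀ hp']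
    rw [div_le_iff₀ hη] at hpc
    linarith
  · calc _ ≤ (η ^ (2 * α + d)) ^ (1 / (2 * α + d)) :=
          Real.rpow_le_rpow (div_nonneg (by linarith) (by positivity)) h1 (by positivity)
      _ = η := by
          rw [← Real.rpow_mul hη.le, mul_one_div_cancel hden.ne', Real.rpow_one]

end Rate

end MeanEst
-- Assembly of the two bounds.
theorem theorem1 (d : ℕ) (hd : 1 ≤ d) (α L β₀ CZ ζ σ c h₀ C₁ C₂ C₃ : ℝ)
    (hα : 0 < α) (hL : 0 < L) (hβ₀ : 0 < β₀) (hβ₀1 : β₀ ≤ 1) (hCZ : 0 < CZ)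
    (hζ : 0 < ζ) (hσ : 0 ≤ σ) (hc : 0 < c) (hh₀ : 0 < h₀)
    (hC₁ : 0 < C₁) (hC₂ : 0 < C₂) (hC₃ : 0 < C₃) :
    -- the bound for all bandwidths in `(c / p_min, h₀]`
    (∃ (K : ℝ) (N : ℕ), ∀ (n : ℕ) (p : Fin d → ℕ), N ≤ n → N ≤ pMin p →
      ∀ (D : ProductDesign p) (w : ℝ → Idx p → cube d → ℝ),
        DesignCondition D c h₀ C₃ →
        (∀ h ∈ Set.Ioc (c / pMin p) h₀, WeightConditions D (strictFloor α) C₁ C₂ h (w h)) →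
      ∀ (Ω Ω' : Type*) [MeasurableSpace Ω] [MeasurableSpace Ω']
        (P : Measure Ω) [IsProbabilityMeasure P] (P' : Measure Ω') [IsProbabilityMeasure P']
        (Z : Ω' → cube d → ℝ) (Zs : Fin n → Ω → cube d → ℝ) (ε : Fin n → Idx p → Ω → ℝ),
        InProcessClass P' β₀ CZ Z → ModelAssumptions P P' ζ σ Z Zs ε →
      ∀ μ ∈ HolderClass (d := d) α L, ∀ h ∈ Set.Ioc (c / pMin p) h₀,
        expectedSupError P D (w h) μ Zs ε ≤ ENNReal.ofReal (K * rate α n p h)) ∧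
    -- the rate for the bandwidth `hStar` with a constant `c' ≥ c`; the endpoint `c / p_min` is not
    -- in the interval above, so that for `c' = c` the weight conditions are required there as well
    (∀ c' : ℝ, c ≤ c' → ∃ (K : ℝ) (N : ℕ), ∀ (n : ℕ) (p : Fin d → ℕ), N ≤ n → N ≤ pMin p →
      ∀ (D : ProductDesign p) (w : ℝ → Idx p → cube d → ℝ),
        DesignCondition D c h₀ C₃ →
        (∀ h ∈ Set.Ioc (c / pMin p) h₀, WeightConditions D (strictFloor α) C₁ C₂ h (w h)) →
        (c' = c → WeightConditions D (strictFloor α) C₁ C₂ (c / pMin p) (w (c / pMin p))) →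
      ∀ (Ω Ω' : Type*) [MeasurableSpace Ω] [MeasurableSpace Ω']
        (P : Measure Ω) [IsProbabilityMeasure P] (P' : Measure Ω') [IsProbabilityMeasure P']
        (Z : Ω' → cube d → ℝ) (Zs : Fin n → Ω → cube d → ℝ) (ε : Fin n → Idx p → Ω → ℝ),
        InProcessClass P' β₀ CZ Z → ModelAssumptions P P' ζ σ Z Zs ε →
      ∀ μ ∈ HolderClass (d := d) α L,
        expectedSupError P D (w (hStar α c' n p)) μ Zs ε ≤
          ENNReal.ofReal (K * optimalRate α n p)) := by
  constructor
  · refine ⟨errorConst d α L β₀ CZ ζ σ C₁ C₂ C₃, 1, ?_⟩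
    intro n p hn hp D w hD hW Ω Ω' _ _ P _ P' _ Z Zs ε hZ hM μ hμ h hh
    have hp' : (0 : ℝ) < pMin p := by exact_mod_cast hp
    exact expectedSupError_le hα hL hβ₀ hCZ hζ hσ hC₁ hC₂ hC₃ hn (pProd_pos hp)
      (lt_trans (by positivity) hh.1) (hD h hh) (hW h hh) hZ hM hμ
  · intro c' hc'
    have hc'pos : 0 < c' := hc.trans_le hc'
    -- Half of `h₀`, so that the doubled bandwidth `2 * H` still lies in the admissible range.
    obtain ⟨N, hN1, hN⟩ := exists_hStar_le (c := c') d hα (half_pos hh₀)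
    refine ⟨errorConst d α L β₀ CZ ζ σ C₁ C₂ (2 ^ d * C₃) *
      (c' ^ α + 1 + Real.sqrt (1 / (2 * α + d))), N, ?_⟩
    intro n p hn hp D w hD hW hWc Ω Ω' _ _ P _ P' _ Z Zs ε hZ hM μ hμ
    obtain ⟨hle, hlog⟩ := hN n p hn hp
    have hp1 : 0 < pMin p := lt_of_lt_of_le one_pos (hN1.trans hp)
    have hn1 : 0 < n := lt_of_lt_of_le one_pos (hN1.trans hn)
    have hp' : (0 : ℝ) < pMin p := by exact_mod_cast hp1
    have hpP := pProd_pos hp1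
    set H := hStar α c' n p with hH
    have hcH : c' / pMin p ≤ H := le_max_left _ _
    have hcc : c / pMin p ≤ c' / pMin p := by gcongr
    have hc0 : 0 < c / (pMin p : ℝ) := by positivity
    have hHpos : 0 < H := hc0.trans_le (hcc.trans hcH)
    have hw : WeightConditions D (strictFloor α) C₁ C₂ H (w H) := by
      -- Equality `H = c / p_min` forces `c' = c`, and only then are the weight conditions at the
      -- endpoint required.
      rcases (hcc.trans hcH).lt_or_eq with hlt | heq
      · exact hW H ⟨hlt, by linarith⟩
      · have hceq : c' = c := by
          refine le_antisymm ?_ hc'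
          rw [← heq] at hcH
          exact (div_le_div_iff_of_pos_right hp').1 hcH
        rw [← heq]
        exact hWc hceq
    have hcard : ∀ x : cube d, (Nat.card {j : Idx p //
        ∀ k, x.1 k - H ≤ (D.pt j).1 k ∧ (D.pt j).1 k ≤ x.1 k + H} : ℝ) ≤
          2 ^ d * C₃ * H ^ d * pProd p := by
      intro x
      calc _ ≤ (Nat.card {j : Idx p //
            ∀ k, x.1 k - 2 * H ≤ (D.pt j).1 k ∧ (D.pt j).1 k ≤ x.1 k + 2 * H} : ℝ) := by
            exact_mod_cast card_box_mono D x (by linarith)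
        -- `2 * H` lies strictly above `c / p_min` even if `H` equals it; the price is the factor `2
        -- ^ d`.
        _ ≤ C₃ * (2 * H) ^ d * pProd p := hD (2 * H) ⟨by linarith, by linarith⟩ x
        _ = _ := by rw [mul_pow]; ring
    have hC₃' : 0 < 2 ^ d * C₃ := by positivity
    refine (expectedSupError_le hα hL hβ₀ hCZ hζ hσ hC₁ hC₂ hC₃' hn1 hpP hHpos hcard hw hZ hM
      hμ).trans (ENNReal.ofReal_le_ofReal ?_)
    rw [mul_assoc]
    refine mul_le_mul_of_nonneg_left (rate_hStar_le hα hc'pos hp1 hlog ?_)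
      (errorConst_nonneg d hL hζ hσ hC₁ hC₂ hC₃')
    have h1 : (0 : ℝ) < n := by exact_mod_cast hn1
    have h2 : (0 : ℝ) < pProd p := by exact_mod_cast hpP
    positivity
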